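/- Notation. Let $\mathbb H^2_{\mathbb C}=\{(\eta,\omega,\psi,\chi)\in\mathbb R^4:\eta>0\}$ carry the Riemannian metric $$g_H=\frac{d\eta^2}{\eta^2}+\frac{(d\omega+2\chi\,d\psi-2\psi\,d\chi)^2}{\eta^2}+4\,\frac{d\chi^2+d\psi^2}{\eta}.$$ For $0<\theta_1<\theta_2<\pi$ and (absolutely continuous) potentials $\mathcal D=(\sigma,\omega,\psi,\chi)$ on $[\theta_1,\theta_2]$ put $\eta=e^{\sigma}\sin^2\theta$ and $$\mathcal M_{\theta_1,\theta_2}(\mathcal D)=\int_{\theta_1}^{\theta_2}\Big(\sigma'^2+4\sigma+\frac{(\omega'+2\chi\psi'-2\psi\chi')^2}{\eta^2}+4\,\frac{\psi'^2+\chi'^2}{\eta}\Big)\sin\theta\,d\theta ,$$ and for (absolutely continuous) curves $\gamma=(\eta,\omega,\psi,\chi)$ in $\mathbb H^2_{\mathbb C}$ put $\tilde{\mathcal M}_{t_1,t_2}(\gamma)=\int_{t_1}^{t_2}g_H(\dot\gamma,\dot\gamma)\,dt$. Both are considered on the objects for which the integral is finite. Write $t=\ln\tan\frac\theta2$; potentials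 $\mathcal D$ as functions of $\theta$ give the curve $\gamma(t)=(\eta,\omega,\psi,\chi)(t)$, and $t_j=\ln\tan\frac{\theta_j}2$. **Lemma.** (1) Let $0<\theta_1<\theta_2<\pi$. For arbitrary Dirichlet data $\mathcal D(\theta_1),\mathcal D(\theta_2)\in\mathbb R^4$ the functional $\mathcal M_{\theta_1,\theta_2}$ has a unique minimizer $\mathcal D=(\sigma,\omega,\psi,\chi)$, and it is smooth on $[\theta_1,\theta_2]$. Moreover $\gamma(t)=\xi(\alpha t+\beta)$ for $t\in[t_1,t_2]$, where $\alpha\ge 0$ and $\xi$ is a geodesic of $\mathbb H^2_{\mathbb C}$ parametrized by arc length, and this arc is length minimizing: ${\rm dist}_{\mathbb H^2_{\mathbb C}}(\gamma(t_1),\gamma(t_2))=\alpha(t_2-t_1)$. (2) Let $t_1<0$, $\eta_1>0$, $\omega_1\neq0$, $\psi_1\in\mathbb R$. There are constants $c_1\ne0$, $c_3$, $c_4$, $c_5=2c_1c_4$ and $\alpha>0$, uniquely determined by the boundary conditions below, such that the curve $$\eta=\Big(\tfrac12c_5^2+\tfrac12\sqrt{4c_1^2+c_5^4}\,\cosh\alpha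 t\Big)^{-1},$$ $$\chi+i\psi=c_4e^{if}+\frac{c_3}{c_1},\qquad f=-2\arctan\Big(\frac{\sqrt{4c_1^2+c_5^4}-c_5^2}{2c_1}\tanh\frac{\alpha t}2\Big),$$ $$\omega=\frac{{\rm sgn}(t)}{c_1}\sqrt{1-c_1^2\eta^2-4c_1^2c_4^2\eta}-\frac{2c_3}{c_1}\psi$$ satisfies the centered boundary conditions $(\eta,\omega,\psi,\chi)(t_1)=(\eta_1,\omega_1,\psi_1,0)$ and $(\eta,\omega,\psi,\chi)(-t_1)=(\eta_1,-\omega_1,-\psi_1,0)$. This curve is the unique minimizer of $\tilde{\mathcal M}_{t_1,-t_1}$ with these boundary values, and on $[t_1,-t_1]$ it has the form $\xi(\alpha t+\beta)$ as in (1), with the same $\alpha$. (3) Let $J,Q,\sigma_l\in\mathbb R$ with $(J,Q)\neq(0,0)$, and define $\Gamma$ by $\sigma_l=\frac12\ln(Q^4+4J^2)+\Gamma$. Let $\theta^i\in(0,\pi/2)$ with $\theta^i\to0$, and let $\sigma_1^i\to\sigma_l$, $\omega_1^i\to-4J$, $\psi_1^i\to-Q$ be real sequences with $\omega_1^i\ne0$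 for all $i$. Then the unique minimizer $\mathcal D^i=(\sigma^i,\omega^i,\psi^i,\chi^i)$ of $\mathcal M_{\theta^i,\pi-\theta^i}$ with $\mathcal D^i(\theta^i)=(\sigma_1^i,\omega_1^i,\psi_1^i,0)$ and $\mathcal D^i(\pi-\theta^i)=(\sigma_1^i,-\omega_1^i,-\psi_1^i,0)$ corresponds to a curve as in (2), with constants $c_1^i,c_3^i,c_4^i,c_5^i,\alpha^i$; in particular $$\sigma^i(\theta)=-\ln\Big[\tfrac12(c_5^i)^2\sin^2\theta+\tfrac12\sqrt{4(c_1^i)^2+(c_5^i)^4}\,\sin^2\theta\cosh\alpha^it\Big],\qquad t=\ln\tan\tfrac\theta2 ,$$ on $[\theta^i,\pi-\theta^i]$, and as $i\to\infty$ $$\alpha^i\to2,\qquad c_5^i\to\frac{-Q}{\sqrt{Q^4+4J^2}},\qquad c_1^i\to\frac{J}{Q^4+4J^2},\qquad \Big(\frac{\theta^i}2\Big)^{\alpha^i-2}\to e^{\Gamma}.$$ -/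

import Mathlib

open Set Filter Topology
open scoped Real ContDiff

noncomputable section

namespace CH2

/-! ### The complex hyperbolic plane

A point of the complex hyperbolic plane is a vector `x : Fin 4 → ℝ` with coordinates
`(x 0, x 1, x 2, x 3) = (η, ω, ψ, χ)` and `η = x 0 > 0`. -/

/-- The one-form `dω + 2 χ dψ - 2 ψ dχ` at the point `(η, ω, ψ, χ)`. -/
def contactForm (x v : Fin 4 → ℝ) : ℝ :=
  v 1 + 2 * x 3 * v 2 - 2 * x 2 * v 3

/-- The Riemannian metric
`g_H = dη² / η² + (dω + 2 χ dψ - 2 ψ dχ)² / η² + 4 (dχ² + dψ²) / η`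
at the point `x`, as a bilinear form in the tangent vectors `v`, `w`. -/
def gH (x v w : Fin 4 → ℝ) : ℝ :=
  v 0 * w 0 / x 0 ^ 2 + contactForm x v * contactForm x w / x 0 ^ 2
    + 4 * (v 3 * w 3 + v 2 * w 2) / x 0

/-- The `k`-th coordinate vector field. -/
def coordVec (k : Fin 4) : Fin 4 → ℝ := Pi.single k 1

/-- The components `g_{ij}` of the metric in the coordinates `(η, ω, ψ, χ)`. -/
def gComp (i j : Fin 4) (x : Fin 4 → ℝ) : ℝ := gH x (coordVec i) (coordVec j)

/-- The partial derivative `∂_k F` at `x`. -/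
def partialD (k : Fin 4) (F : (Fin 4 → ℝ) → ℝ) (x : Fin 4 → ℝ) : ℝ :=
  fderiv ℝ F x (coordVec k)

/-- The Christoffel symbols of the Levi-Civita connection with the upper index lowered,
`Γ_{k,ij} = (∂_i g_{jk} + ∂_j g_{ik} - ∂_k g_{ij}) / 2`. -/
def christoffel (k i j : Fin 4) (x : Fin 4 → ℝ) : ℝ :=
  (partialD i (gComp j k) x + partialD j (gComp i k) x - partialD k (gComp i j) x) / 2

/-- `ξ` is a (complete) geodesic of the complex hyperbolic plane, parametrized by arc length: a
smooth unit speed curve with vanishing covariant acceleration, the equation `∇_{ξ'} ξ' = 0` being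
written with its free index lowered, `g_{kj} ξ''^j + Γ_{k,ij} ξ'^i ξ'^j = 0`. -/
structure IsUnitSpeedGeodesic (ξ : ℝ → Fin 4 → ℝ) : Prop where
  smooth : ContDiff ℝ ∞ ξ
  pos : ∀ s, 0 < ξ s 0
  unit_speed : ∀ s, gH (ξ s) (deriv ξ s) (deriv ξ s) = 1
  geodesic : ∀ s k,
    ∑ j, gComp k j (ξ s) * deriv (deriv ξ) s j
      + ∑ i, ∑ j, christoffel k i j (ξ s) * deriv ξ s i * deriv ξ s j = 0

/-- The Riemannian length of a curve `c : [0, 1] → ℍ²_ℂ`. -/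
def curveLength (c : ℝ → Fin 4 → ℝ) : ℝ :=
  ∫ s in (0 : ℝ)..1, √(gH (c s) (deriv c s) (deriv c s))

/-- The Riemannian distance: the infimum of the lengths of the `C¹` curves from `x` to `y`. -/
def hdist (x y : Fin 4 → ℝ) : ℝ :=
  sInf {L | ∃ c : ℝ → Fin 4 → ℝ, ContDiffOn ℝ 1 c (Icc 0 1) ∧ (∀ s ∈ Icc (0 : ℝ) 1, 0 < c s 0) ∧
    c 0 = x ∧ c 1 = y ∧ L = curveLength c}

/-- On `[t₁, t₂]` the curve `γ` is `γ(t) = ξ(α t + β)` with `α ≥ 0` and `ξ` a geodesic parametrized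
by arc length, and the arc of `ξ` that `γ` runs through (its length is `α (t₂ - t₁)`) realizes
the distance between its end points. -/
def IsAffineMinimizingGeodesic (γ : ℝ → Fin 4 → ℝ) (t₁ t₂ α : ℝ) : Prop :=
  0 ≤ α ∧ (∃ (ξ : ℝ → Fin 4 → ℝ) (β : ℝ), IsUnitSpeedGeodesic ξ ∧
    ∀ t ∈ Icc t₁ t₂, γ t = ξ (α * t + β)) ∧
  hdist (γ t₁) (γ t₂) = α * (t₂ - t₁)

/-! ### The energy `∫ g_H(γ', γ') dt` -/

/-- The integrand `η'² / η² + (ω' + 2 χ ψ' - 2 ψ χ')² / η² + 4 (χ'² + ψ'²) / η`. -/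
def energyDensity (γ : ℝ → Fin 4 → ℝ) (t : ℝ) : ℝ :=
  gH (γ t) (deriv γ t) (deriv γ t)

/-- The energy of a curve on `[t₁, t₂]`. -/
def energy (t₁ t₂ : ℝ) (γ : ℝ → Fin 4 → ℝ) : ℝ :=
  ∫ t in t₁..t₂, energyDensity γ t

/-- The curves on which the energy is considered, with end points `p` and `q`: absolutely
continuous curves in `{η > 0}` of finite energy. -/
structure EnergyAdmissible (t₁ t₂ : ℝ) (p q : Fin 4 → ℝ) (γ : ℝ → Fin 4 → ℝ) : Prop where
  ac : ∀ k, AbsolutelyContinuousOnInterval (fun t => γ t k) t₁ t₂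
  pos : ∀ t ∈ Icc t₁ t₂, 0 < γ t 0
  finite : IntervalIntegrable (energyDensity γ) MeasureTheory.volume t₁ t₂
  left : γ t₁ = p
  right : γ t₂ = q

/-- `γ` minimizes the energy on `[t₁, t₂]` among the curves from `p` to `q`. -/
def IsEnergyMinimizer (t₁ t₂ : ℝ) (p q : Fin 4 → ℝ) (γ : ℝ → Fin 4 → ℝ) : Prop :=
  EnergyAdmissible t₁ t₂ p q γ ∧
    ∀ ζ, EnergyAdmissible t₁ t₂ p q ζ → energy t₁ t₂ γ ≤ energy t₁ t₂ ζ

/-! ### The functional `𝓜` on potentials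

A set of axisymmetric potentials is a function `D : ℝ → Fin 4 → ℝ` of the polar angle `θ`, with
`(D θ 0, D θ 1, D θ 2, D θ 3) = (σ, ω, ψ, χ)`. -/

/-- The squared norm `η = e^σ sin² θ`. -/
def etaOf (D : ℝ → Fin 4 → ℝ) (θ : ℝ) : ℝ := Real.exp (D θ 0) * Real.sin θ ^ 2

/-- The integrand
`(σ'² + 4 σ + (ω' + 2 χ ψ' - 2 ψ χ')² / η² + 4 (ψ'² + χ'²) / η) sin θ`. -/
def massDensity (D : ℝ → Fin 4 → ℝ) (θ : ℝ) : ℝ :=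
  (deriv D θ 0 ^ 2 + 4 * D θ 0
    + (deriv D θ 1 + 2 * D θ 3 * deriv D θ 2 - 2 * D θ 2 * deriv D θ 3) ^ 2 / etaOf D θ ^ 2
    + 4 * (deriv D θ 2 ^ 2 + deriv D θ 3 ^ 2) / etaOf D θ) * Real.sin θ

/-- The functional `𝓜_{θ₁,θ₂}`. -/
def mass (θ₁ θ₂ : ℝ) (D : ℝ → Fin 4 → ℝ) : ℝ :=
  ∫ θ in θ₁..θ₂, massDensity D θ

/-- The potentials on which `𝓜_{θ₁,θ₂}` is considered, with Dirichlet data `p` at `θ₁` and `q` at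
`θ₂`: absolutely continuous potentials on `[θ₁, θ₂]` for which the integral is finite. -/
structure MassAdmissible (θ₁ θ₂ : ℝ) (p q : Fin 4 → ℝ) (D : ℝ → Fin 4 → ℝ) : Prop where
  ac : ∀ k, AbsolutelyContinuousOnInterval (fun θ => D θ k) θ₁ θ₂
  finite : IntervalIntegrable (massDensity D) MeasureTheory.volume θ₁ θ₂
  left : D θ₁ = p
  right : D θ₂ = q

/-- `D` minimizes `𝓜_{θ₁,θ₂}` with Dirichlet data `p` at `θ₁` and `q` at `θ₂`. -/
def IsMassMinimizer (θ₁ θ₂ : ℝ) (p q : Fin 4 → ℝ) (D : ℝ → Fin 4 → ℝ) : Prop :=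
  MassAdmissible θ₁ θ₂ p q D ∧
    ∀ E, MassAdmissible θ₁ θ₂ p q E → mass θ₁ θ₂ D ≤ mass θ₁ θ₂ E

/-- The variable `t = ln tan (θ / 2)`. -/
def tOf (θ : ℝ) : ℝ := Real.log (Real.tan (θ / 2))

/-- Its inverse `θ = 2 arctan e^t`. -/
def thetaOf (t : ℝ) : ℝ := 2 * Real.arctan (Real.exp t)

/-- The curve `γ(t) = (η, ω, ψ, χ)(t)` in the complex hyperbolic plane given by potentials `D`. -/
def curveOf (D : ℝ → Fin 4 → ℝ) (t : ℝ) : Fin 4 → ℝ :=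
  ![etaOf D (thetaOf t), D (thetaOf t) 1, D (thetaOf t) 2, D (thetaOf t) 3]

/-! ### The explicit curves -/

/-- The constants in the explicit expressions. -/
structure Consts where
  c₁ : ℝ
  c₃ : ℝ
  c₄ : ℝ
  c₅ : ℝ
  α : ℝ

namespace Consts

/-- `c₁ ≠ 0`, `c₅ = 2 c₁ c₄`, `α > 0`. -/
def Valid (c : Consts) : Prop := c.c₁ ≠ 0 ∧ c.c₅ = 2 * c.c₁ * c.c₄ ∧ 0 < c.α

/-- `η = (c₅² / 2 + √(4 c₁² + c₅⁴) cosh (α t) / 2)⁻¹`. -/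
def eta (c : Consts) (t : ℝ) : ℝ :=
  (1 / 2 * c.c₅ ^ 2 + 1 / 2 * √(4 * c.c₁ ^ 2 + c.c₅ ^ 4) * Real.cosh (c.α * t))⁻¹

/-- `f = -2 arctan ((√(4 c₁² + c₅⁴) - c₅²) / (2 c₁) · tanh (α t / 2))`. -/
def f (c : Consts) (t : ℝ) : ℝ :=
  -2 * Real.arctan
    ((√(4 * c.c₁ ^ 2 + c.c₅ ^ 4) - c.c₅ ^ 2) / (2 * c.c₁) * Real.tanh (c.α * t / 2))

/-- The complex number `χ + i ψ = c₄ e^{i f} + c₃ / c₁`. -/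
def chiPsi (c : Consts) (t : ℝ) : ℂ :=
  c.c₄ * Complex.exp (Complex.I * (c.f t : ℂ)) + ((c.c₃ / c.c₁ : ℝ) : ℂ)

/-- `ω = (sgn t / c₁) √(1 - c₁² η² - 4 c₁² c₄² η) - 2 (c₃ / c₁) ψ`. -/
def omega (c : Consts) (t : ℝ) : ℝ :=
  Real.sign t / c.c₁ * √(1 - c.c₁ ^ 2 * c.eta t ^ 2 - 4 * c.c₁ ^ 2 * c.c₄ ^ 2 * c.eta t)
    - 2 * (c.c₃ / c.c₁) * (c.chiPsi t).im

/-- The curve `(η, ω, ψ, χ)(t)` with the constants `c`. -/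
def curve (c : Consts) (t : ℝ) : Fin 4 → ℝ :=
  ![c.eta t, c.omega t, (c.chiPsi t).im, (c.chiPsi t).re]

end Consts

end CH2

end

open CH2

/-! Put U = η + χ² + ψ² - iω and z = χ + iψ. Then dU - 2 z̄ dz = dη - i(dω + 2χ dψ - 2ψ dχ), so that
g_H = |dU - 2 z̄ dz|² / η² + 4 |dz|² / η. Heisenberg translations and the inversion (U, z) ↦ (1/U,
z/U) preserve this metric, and they suffice to carry any two points onto the vertical line s ↦ (e^s,
0, 0, 0) (`exists_isometryPair`).

On that line everything follows from one inequality, (dη/η)² ≤ g_H (`sq_le_gH`): log η is a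
calibration. It makes the line a geodesic (`isUnitSpeedGeodesic_of_calibration`) and bounds the
length of every C¹ curve from below (`sub_le_curveLength`). After completing a square it also bounds
the energy from below, with equality only for the affinely parametrized line
(`weighted_energy_lower_bound`). The minimizer is thus written down and compared with every
competitor; no compactness argument is involved.

The energy bound carries a weight w, and the parameter τ satisfies τ' = 1/w. The choice w = 1 is the
energy in t. The choice w = sin θ, τ = ln tan(θ/2) is the same energy in the variable θ, and it
differs from 𝓜 only by a quantity fixed by the Dirichlet data (`massDensity_eq`). This settles (1).

For (2), the explicit curve is rational in e^{αt} and is the image of the vertical line under a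
composition of translations and an inversion (`Consts.Valid.exists_isometryPair`), hence minimizing.
The boundary conditions can be solved in closed form: sinh(α|t₁|) = √(ω₁² + 4ψ₁⁴ + 4η₁ψ₁²) / η₁
determines α, and then c₅, c₁, c₃ follow (`curve_constsOf_left`, `consts_of_boundary`).

For (3), uniqueness in (1) identifies the minimizer with the explicit curve, and the limits are read
off from the closed formulas; the formula for α is arsinh written as a logarithm (`constsOf_α`). -/

namespace CH2

/-! ### Isometries of the complex hyperbolic plane -/

/-- `Φ` is a smooth metric preserving self-map of `{η > 0}`. -/
structure IsMetricMap (Φ : (Fin 4 → ℝ) → Fin 4 → ℝ) : Prop where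
  pos : ∀ x, 0 < x 0 → 0 < Φ x 0
  smooth : ∀ x, 0 < x 0 → ContDiffAt ℝ ∞ Φ x
  metric : ∀ x v, 0 < x 0 → gH (Φ x) (fderiv ℝ Φ x v) (fderiv ℝ Φ x v) = gH x v v

/-- `Φ` and `Ψ` are mutually inverse isometries of `{η > 0}`. -/
structure IsIsometryPair (Φ Ψ : (Fin 4 → ℝ) → Fin 4 → ℝ) : Prop where
  left : IsMetricMap Φ
  right : IsMetricMap Ψ
  left_inv : ∀ x, 0 < x 0 → Ψ (Φ x) = x
  right_inv : ∀ x, 0 < x 0 → Φ (Ψ x) = x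

theorem IsMetricMap.differentiableAt {Φ : (Fin 4 → ℝ) → Fin 4 → ℝ} (h : IsMetricMap Φ)
    {x : Fin 4 → ℝ} (hx : 0 < x 0) : DifferentiableAt ℝ Φ x :=
  (h.smooth x hx).differentiableAt (by simp)

theorem IsMetricMap.comp {Φ Φ' : (Fin 4 → ℝ) → Fin 4 → ℝ} (h : IsMetricMap Φ)
    (h' : IsMetricMap Φ') : IsMetricMap (Φ ∘ Φ') where
  pos x hx := h.pos _ (h'.pos x hx)
  smooth x hx := (h.smooth _ (h'.pos x hx)).comp x (h'.smooth x hx)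
  metric x v hx := by
    rw [fderiv_comp x (h.differentiableAt (h'.pos x hx)) (h'.differentiableAt hx)]
    simp only [ContinuousLinearMap.comp_apply, Function.comp_apply]
    rw [h.metric _ _ (h'.pos x hx), h'.metric _ _ hx]

theorem IsIsometryPair.trans {Φ Ψ Φ' Ψ' : (Fin 4 → ℝ) → Fin 4 → ℝ} (h : IsIsometryPair Φ Ψ)
    (h' : IsIsometryPair Φ' Ψ') : IsIsometryPair (Φ ∘ Φ') (Ψ' ∘ Ψ) where
  left := h.left.comp h'.left
  right := h'.right.comp h.right
  left_inv x hx := by simp [h.left_inv _ (h'.left.pos x hx), h'.left_inv x hx]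
  right_inv x hx := by simp [h'.right_inv _ (h.right.pos x hx), h.right_inv x hx]

/-- A smooth map is metric preserving if its derivatives along lines say so. -/
theorem IsMetricMap.of_hasDerivAt {Φ : (Fin 4 → ℝ) → Fin 4 → ℝ}
    (pos : ∀ x, 0 < x 0 → 0 < Φ x 0) (smooth : ∀ x, 0 < x 0 → ContDiffAt ℝ ∞ Φ x)
    (A : (Fin 4 → ℝ) → (Fin 4 → ℝ) → Fin 4 → ℝ)
    (hA : ∀ x v, 0 < x 0 → ∀ k, HasDerivAt (fun t : ℝ => Φ (x + t • v) k) (A x v k) 0)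
    (hg : ∀ x v, 0 < x 0 → gH (Φ x) (A x v) (A x v) = gH x v v) : IsMetricMap Φ where
  pos := pos
  smooth := smooth
  metric x v hx := by
    have h1 : HasLineDerivAt ℝ Φ (fderiv ℝ Φ x v) x v :=
      ((smooth x hx).differentiableAt (by simp)).hasFDerivAt.hasLineDerivAt v
    have h2 : HasLineDerivAt ℝ Φ (A x v) x v := hasDerivAt_pi.2 (hA x v hx)
    rw [h1.unique h2]
    exact hg x v hx

/-- The Heisenberg translation by `(s, a, b)` in the variables `(ω, ψ, χ)`. -/
def translation (s a b : ℝ) (x : Fin 4 → ℝ) : Fin 4 → ℝ :=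
  ![x 0, x 1 + s - 2 * (b * x 2 - a * x 3), x 2 + a, x 3 + b]

theorem isMetricMap_translation (s a b : ℝ) : IsMetricMap (translation s a b) := by
  refine IsMetricMap.of_hasDerivAt (fun x hx => by simpa [translation] using hx) (fun x _ => ?_)
    (fun x v => ![v 0, v 1 - 2 * (b * v 2 - a * v 3), v 2, v 3]) (fun x v _ k => ?_)
    (fun x v _ => ?_)
  · refine contDiffAt_pi.2 fun k => ?_
    fin_cases k <;> simp [translation] <;> fun_prop
  · have h (j : Fin 4) : HasDerivAt (fun t : ℝ => x j + t * v j) (v j) 0 := by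
      simpa using ((hasDerivAt_id (0 : ℝ)).mul_const (v j)).const_add (x j)
    fin_cases k
    · simpa [translation] using h 0
    · simpa [translation] using ((h 1).add_const s).fun_sub
        ((((h 2).const_mul b).fun_sub ((h 3).const_mul a)).const_mul 2)
    · simpa [translation] using (h 2).add_const a
    · simpa [translation] using (h 3).add_const b
  · simp [translation, gH, contactForm]
    ring

theorem isIsometryPair_translation (s a b : ℝ) :
    IsIsometryPair (translation s a b) (translation (-s) (-a) (-b)) where
  left := isMetricMap_translation _ _ _
  right := isMetricMap_translation _ _ _
  left_inv x _ := by
    ext k; fin_cases k <;> simp [translation]; ring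
  right_inv x _ := by
    ext k; fin_cases k <;> simp [translation]; ring

/-- `|η + χ² + ψ² - i ω|²`. -/
def normU (x : Fin 4 → ℝ) : ℝ := (x 0 + x 2 ^ 2 + x 3 ^ 2) ^ 2 + x 1 ^ 2

theorem normU_pos {x : Fin 4 → ℝ} (hx : 0 < x 0) : 0 < normU x := by
  unfold normU; positivity

/-- The inversion `(U, z) ↦ (1 / U, z / U)`, where `U = η + χ² + ψ² - i ω` and `z = χ + i ψ`. -/
noncomputable def inversion (x : Fin 4 → ℝ) : Fin 4 → ℝ :=
  ![x 0 / normU x, -x 1 / normU x,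
    (x 2 * (x 0 + x 2 ^ 2 + x 3 ^ 2) + x 3 * x 1) / normU x,
    (x 3 * (x 0 + x 2 ^ 2 + x 3 ^ 2) - x 2 * x 1) / normU x]

theorem normU_inversion {x : Fin 4 → ℝ} (hx : 0 < x 0) : normU (inversion x) = 1 / normU x := by
  have h := (normU_pos hx).ne'
  have h2 : normU x = (x 0 + x 2 ^ 2 + x 3 ^ 2) ^ 2 + x 1 ^ 2 := rfl
  have h3 : inversion x 0 + inversion x 2 ^ 2 + inversion x 3 ^ 2
      = (x 0 + x 2 ^ 2 + x 3 ^ 2) / normU x := by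
    simp [inversion]
    field_simp
    rw [h2]; ring
  have h4 : inversion x 1 = - x 1 / normU x := by simp [inversion]
  rw [normU, h3, h4]
  field_simp
  rw [h2]

theorem inversion_inversion {x : Fin 4 → ℝ} (hx : 0 < x 0) : inversion (inversion x) = x := by
  have h := (normU_pos hx).ne'
  have h2 : normU x = (x 0 + x 2 ^ 2 + x 3 ^ 2) ^ 2 + x 1 ^ 2 := rfl
  have h3 : inversion x 0 + inversion x 2 ^ 2 + inversion x 3 ^ 2
      = (x 0 + x 2 ^ 2 + x 3 ^ 2) / normU x := by
    simp [inversion]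
    field_simp
    rw [h2]; ring
  rw [inversion, normU_inversion hx, h3]
  ext k
  fin_cases k <;> simp [inversion] <;> field_simp <;> rw [h2] <;> ring

/-- The inversion mixes the two parts of the metric, so only their sum is invariant. This is that
invariance multiplied by n² η², with e = dη, θ the contact form, d + ik = z dz̄, r = |z|², q =
|dz|², a = Re U and n = |U|². -/
theorem inversion_algebra {a x1 η r q d k n : ℝ} (e θ : ℝ) (hd : d ^ 2 + k ^ 2 = r * q)
    (hn : n = a ^ 2 + x1 ^ 2) (ha : a = η + r) :
    (e * n - η * (2 * a * (e + 2 * d) + 2 * x1 * (θ - 2 * k))) ^ 2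
      + (θ * (n - 2 * η * a) + 2 * η * x1 * e + 4 * η * (d * x1 + k * a)) ^ 2
      + 4 * (q * n + r * ((e + 2 * d) ^ 2 + (θ - 2 * k) ^ 2)
          - 2 * ((d * a + k * x1) * (e + 2 * d) - (k * a - d * x1) * (θ - 2 * k))) * n * η
      = n ^ 2 * (e ^ 2 + θ ^ 2 + 4 * q * η) := by
  subst hn
  obtain rfl : r = a - η := by linarith
  ring

theorem inversion_contactForm (x v : Fin 4 → ℝ) (hx : 0 < x 0) :
    let a := x 0 + x 2 ^ 2 + x 3 ^ 2
    let a' := v 0 + 2 * x 2 * v 2 + 2 * x 3 * v 3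
    let n := normU x
    let n' := 2 * a * a' + 2 * x 1 * v 1
    contactForm ![x 0 / n, -x 1 / n, (x 2 * a + x 3 * x 1) / n, (x 3 * a - x 2 * x 1) / n]
      ![(v 0 * n - x 0 * n') / n ^ 2, (-v 1 * n - (-x 1) * n') / n ^ 2,
        ((v 2 * a + x 2 * a' + (v 3 * x 1 + x 3 * v 1)) * n - (x 2 * a + x 3 * x 1) * n') / n ^ 2,
        ((v 3 * a + x 3 * a' - (v 2 * x 1 + x 2 * v 1)) * n - (x 3 * a - x 2 * x 1) * n') / n ^ 2]
      = (contactForm x v * (n - 2 * x 0 * a) + 2 * x 0 * x 1 * v 0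
        + 4 * x 0 * ((x 2 * v 2 + x 3 * v 3) * x 1 + (x 3 * v 2 - x 2 * v 3) * a)) / n ^ 2 := by
  intro a a' n n'
  have h : n ≠ 0 := (normU_pos hx).ne'
  have hn : n = a ^ 2 + x 1 ^ 2 := rfl
  have hv : v 0 = a' - 2 * x 2 * v 2 - 2 * x 3 * v 3 := by simp only [a']; ring
  have hx0 : x 0 = a - x 2 ^ 2 - x 3 ^ 2 := by simp only [a]; ring
  simp only [contactForm, Matrix.cons_val, n']
  rw [hv, hx0]
  clear_value a a' n
  field_simp
  subst hn
  ring

theorem inversion_speed (x v : Fin 4 → ℝ) (hx : 0 < x 0) :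
    let a := x 0 + x 2 ^ 2 + x 3 ^ 2
    let a' := v 0 + 2 * x 2 * v 2 + 2 * x 3 * v 3
    let n := normU x
    let n' := 2 * a * a' + 2 * x 1 * v 1
    let d := x 2 * v 2 + x 3 * v 3
    let k := x 3 * v 2 - x 2 * v 3
    (((v 2 * a + x 2 * a' + (v 3 * x 1 + x 3 * v 1)) * n - (x 2 * a + x 3 * x 1) * n')
        / n ^ 2) ^ 2
      + (((v 3 * a + x 3 * a' - (v 2 * x 1 + x 2 * v 1)) * n - (x 3 * a - x 2 * x 1) * n')
        / n ^ 2) ^ 2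
      = ((v 2 ^ 2 + v 3 ^ 2) * n + (x 2 ^ 2 + x 3 ^ 2)
          * ((v 0 + 2 * d) ^ 2 + (contactForm x v - 2 * k) ^ 2)
          - 2 * ((d * a + k * x 1) * (v 0 + 2 * d)
            - (k * a - d * x 1) * (contactForm x v - 2 * k))) / n ^ 2 := by
  intro a a' n n' d k
  have h : n ≠ 0 := (normU_pos hx).ne'
  have hn : n = a ^ 2 + x 1 ^ 2 := rfl
  have hv : v 0 + 2 * d = a' := by simp only [a', d]; ring
  have hk : contactForm x v - 2 * k = v 1 := by simp only [contactForm, k]; ring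
  rw [hv, hk]
  simp only [n', d, k]
  clear_value a a' n
  field_simp
  subst hn
  ring

theorem isMetricMap_inversion : IsMetricMap inversion := by
  refine IsMetricMap.of_hasDerivAt (fun x hx => div_pos hx (normU_pos hx)) (fun x hx => ?_)
    (fun x v =>
      let a := x 0 + x 2 ^ 2 + x 3 ^ 2
      let a' := v 0 + 2 * x 2 * v 2 + 2 * x 3 * v 3
      let n := normU x
      let n' := 2 * a * a' + 2 * x 1 * v 1
      ![(v 0 * n - x 0 * n') / n ^ 2, (-v 1 * n - (-x 1) * n') / n ^ 2,
        ((v 2 * a + x 2 * a' + (v 3 * x 1 + x 3 * v 1)) * n - (x 2 * a + x 3 * x 1) * n') / n ^ 2,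
        ((v 3 * a + x 3 * a' - (v 2 * x 1 + x 2 * v 1)) * n - (x 3 * a - x 2 * x 1) * n') / n ^ 2])
    (fun x v hx k => ?_) (fun x v hx => ?_)
  · have h := (normU_pos hx).ne'
    unfold normU at h
    refine contDiffAt_pi.2 fun k => ?_
    fin_cases k <;> simp [inversion, normU] <;> refine ContDiffAt.div ?_ ?_ h <;> fun_prop
  · have h (j : Fin 4) : HasDerivAt (fun t : ℝ => x j + t * v j) (v j) 0 := by
      simpa using ((hasDerivAt_id (0 : ℝ)).mul_const (v j)).const_add (x j)
    have hn0 := (normU_pos hx).ne'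
    have ha : HasDerivAt (fun t : ℝ => (x 0 + t * v 0) + (x 2 + t * v 2) ^ 2 + (x 3 + t * v 3) ^ 2)
        (v 0 + 2 * x 2 * v 2 + 2 * x 3 * v 3) 0 := by
      convert! ((h 0).add ((h 2).pow 2)).add ((h 3).pow 2) using 1
      simp
    have hn : HasDerivAt (fun t : ℝ => normU (x + t • v))
        (2 * (x 0 + x 2 ^ 2 + x 3 ^ 2) * (v 0 + 2 * x 2 * v 2 + 2 * x 3 * v 3)
          + 2 * x 1 * v 1) 0 := by
      convert! (ha.pow 2).add ((h 1).pow 2) using 1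
      simp
    have hn0' : normU (x + (0 : ℝ) • v) ≠ 0 := by simpa using hn0
    fin_cases k
    · simpa [inversion] using (h 0).fun_div hn hn0'
    · simpa [inversion] using (h 1).fun_neg.fun_div hn hn0'
    · simpa [inversion] using (((h 2).fun_mul ha).fun_add ((h 3).fun_mul (h 1))).fun_div hn hn0'
    · simpa [inversion] using (((h 3).fun_mul ha).fun_sub ((h 2).fun_mul (h 1))).fun_div hn hn0'
  · have h := (normU_pos hx).ne'
    have hx' := hx.ne'
    have hn : normU x = (x 0 + x 2 ^ 2 + x 3 ^ 2) ^ 2 + x 1 ^ 2 := rfl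
    have hd : (x 2 * v 2 + x 3 * v 3) ^ 2 + (x 3 * v 2 - x 2 * v 3) ^ 2
      = (x 2 ^ 2 + x 3 ^ 2) * (v 2 ^ 2 + v 3 ^ 2) := by ring
    have hal := inversion_algebra (v 0) (contactForm x v) hd hn
      (show x 0 + x 2 ^ 2 + x 3 ^ 2 = x 0 + (x 2 ^ 2 + x 3 ^ 2) by ring)
    simp only [gH, inversion, Matrix.cons_val]
    rw [inversion_contactForm x v hx]
    have hz := inversion_speed x v hx
    simp only at hz
    rw [show ∀ p q r s : ℝ, 4 * (p * p + q * q) / (r / s) = 4 * (q ^ 2 + p ^ 2) / (r / s) by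
      intros; ring, hz]
    have hk : v 1 = contactForm x v - 2 * (x 3 * v 2 - x 2 * v 3) := by
      unfold contactForm; ring
    rw [hk]
    set θ := contactForm x v
    set n := normU x
    field_simp
    linear_combination hal

theorem isIsometryPair_inversion : IsIsometryPair inversion inversion where
  left := isMetricMap_inversion
  right := isMetricMap_inversion
  left_inv _ hx := inversion_inversion hx
  right_inv _ hx := inversion_inversion hx

/-- The point `(e^s, 0, 0, 0)` of the vertical geodesic. -/
noncomputable def vert (s : ℝ) : Fin 4 → ℝ := ![Real.exp s, 0, 0, 0]

theorem vert_pos (s : ℝ) : 0 < vert s 0 := by simp [vert, Real.exp_pos]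

theorem inversion_vert (s : ℝ) : inversion (vert s) = vert (-s) := by
  ext k
  fin_cases k <;> simp [inversion, normU, vert, Real.exp_neg]
  field_simp

theorem hasDerivAt_vert (s : ℝ) : HasDerivAt vert ![Real.exp s, 0, 0, 0] s := by
  refine hasDerivAt_pi.2 fun k => ?_
  fin_cases k
  · simpa [vert] using Real.hasDerivAt_exp s
  all_goals simpa [vert] using! hasDerivAt_const s (0 : ℝ)

theorem contDiff_vert : ContDiff ℝ ∞ vert := by
  refine contDiff_pi.2 fun k => ?_
  fin_cases k <;> simp [vert] <;> fun_prop

/-! ### Any two points lie on the image of the vertical geodesic under an isometry -/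

/-- The complex coordinate `U = η + |z|² - i ω`. -/
def coordU (x : Fin 4 → ℝ) : ℂ := ⟨x 0 + x 2 ^ 2 + x 3 ^ 2, -x 1⟩

/-- The complex coordinate `z = χ + i ψ`. -/
def coordZ (x : Fin 4 → ℝ) : ℂ := ⟨x 3, x 2⟩

theorem normSq_coordU (x : Fin 4 → ℝ) : Complex.normSq (coordU x) = normU x := by
  simp [Complex.normSq_apply, coordU, normU]; ring

theorem coordU_ne_zero {x : Fin 4 → ℝ} (hx : 0 < x 0) : coordU x ≠ 0 := by
  rw [← Complex.normSq_pos, normSq_coordU]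
  exact normU_pos hx

theorem coordU_inversion {x : Fin 4 → ℝ} (hx : 0 < x 0) :
    coordU (inversion x) = (coordU x)⁻¹ := by
  have h := (normU_pos hx).ne'
  have h2 : normU x = (x 0 + x 2 ^ 2 + x 3 ^ 2) ^ 2 + x 1 ^ 2 := rfl
  apply Complex.ext
  · rw [Complex.inv_re, normSq_coordU]
    simp [coordU, inversion]
    field_simp
    rw [h2]; ring
  · rw [Complex.inv_im, normSq_coordU]
    simp [coordU, inversion]
    ring

theorem coordZ_inversion (x : Fin 4 → ℝ) :
    coordZ (inversion x) = coordZ x / coordU x := by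
  apply Complex.ext
  · rw [Complex.div_re, normSq_coordU]
    simp [coordU, coordZ, inversion]
    ring
  · rw [Complex.div_im, normSq_coordU]
    simp [coordU, coordZ, inversion]
    ring

theorem coordZ_translation (s a b : ℝ) (x : Fin 4 → ℝ) :
    coordZ (translation s a b x) = coordZ x + ⟨b, a⟩ := by
  apply Complex.ext <;> simp [coordZ, translation]

theorem coordU_translation (s a b : ℝ) (x : Fin 4 → ℝ) :
    coordU (translation s a b x)
      = coordU x + ⟨b ^ 2 + a ^ 2, -s⟩ + 2 * (starRingEnd ℂ ⟨b, a⟩) * coordZ x := by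
  apply Complex.ext <;> simp [coordU, coordZ, translation] <;> ring

/-- The end point at infinity of the geodesic through `(h, 0)` and `(U, z)`. -/
theorem exists_translation_data {h η : ℝ} (hh : 0 < h) (hη : 0 < η) {U z : ℂ}
    (hU : U.re = η + Complex.normSq z) (hne : ¬ (z = 0 ∧ U.im = 0)) :
    ∃ (a E : ℂ), E.re = Complex.normSq a ∧
      a * (U + E + 2 * starRingEnd ℂ a * z) = (z + a) * (h + E) ∧
      ((h + E)⁻¹ - (U + E + 2 * starRingEnd ℂ a * z)⁻¹).im = 0 := by
  set m : ℝ := Complex.normSq (h + U) with hm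
  have hnz : 0 ≤ Complex.normSq z := Complex.normSq_nonneg z
  have hm' : m = (h + U.re) ^ 2 + U.im ^ 2 := by
    simp [hm, Complex.normSq_apply]; ring
  have hm0 : 4 * h * η ≤ m := by
    rw [hm', hU]
    nlinarith [sq_nonneg (h - η), sq_nonneg U.im, mul_nonneg hh.le hnz, mul_nonneg hη.le hnz]
  have hmpos : 0 < m := lt_of_lt_of_le (by positivity) hm0
  -- In homogeneous coordinates the points at infinity of the geodesic are the null vectors p + κq
  -- with κ = c (h + Ū) and c real: this phase makes the Hermitian cross term real. Nullness is this
  -- quadratic equation for c, and m ≥ 4hη makes its discriminant nonnegative.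
  obtain ⟨c, hc⟩ : ∃ c : ℝ, h + c * m + c ^ 2 * m * η = 0 := by
    have hdisc : 0 ≤ m ^ 2 - 4 * (m * η) * h := by nlinarith
    refine ⟨(-m + √(m ^ 2 - 4 * (m * η) * h)) / (2 * (m * η)), ?_⟩
    have := Real.sq_sqrt hdisc
    set r := √(m ^ 2 - 4 * (m * η) * h)
    field_simp
    linear_combination this
  set κ : ℂ := c * (h + starRingEnd ℂ U) with hκ
  have hnorm : (h + U) * (h + starRingEnd ℂ U) = (m : ℂ) := by
    rw [hm, ← Complex.mul_conj]; simp
  have hzz : z * starRingEnd ℂ z = (Complex.normSq z : ℂ) := Complex.mul_conj z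
  have hUU : U + starRingEnd ℂ U = 2 * ((η + Complex.normSq z : ℝ) : ℂ) := by
    rw [← hU, Complex.add_conj]; push_cast; ring
  have hcC : (h : ℂ) + c * m + c ^ 2 * m * η = 0 := by exact_mod_cast hc
  have hκc : starRingEnd ℂ κ = c * (h + U) := by simp [hκ]
  -- The end point lies at infinity of the chart only if κ = -1, and this forces z = 0 and Im U = 0,
  -- the excluded case.
  have hD : 1 + κ ≠ 0 := by
    intro h0
    have hre := congrArg Complex.re h0
    have him := congrArg Complex.im h0
    simp [hκ] at hre him
    have hc0 : c ≠ 0 := by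
      rintro rfl; simp at hre
    have hUim : U.im = 0 := by tauto
    apply hne
    have h1 : c * (h + U.re) = -1 := by linarith
    have h2 : h - (h + U.re) + η = 0 := by
      rw [hm', hUim] at hc
      linear_combination hc + (-(h + U.re) + (1 - c * (h + U.re)) * η) * h1
    exact ⟨Complex.normSq_eq_zero.1 (by linarith), hUim⟩
  have hDc : 1 + starRingEnd ℂ κ ≠ 0 := by
    have h0 := (map_ne_zero (starRingEnd ℂ)).2 hD
    rwa [map_add, map_one] at h0
  set W := starRingEnd ℂ U with hW
  set zc := starRingEnd ℂ z with hzc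
  -- The end point has z-coordinate κz / (1 + κ) = -a and U-coordinate (h + κU) / (1 + κ) = Ē, so
  -- the translation by (a, E) brings it to the origin.
  set a : ℂ := -κ * z / (1 + κ) with ha
  set E : ℂ := (h + starRingEnd ℂ κ * W) / (1 + starRingEnd ℂ κ) with hE
  have hac : starRingEnd ℂ a = -starRingEnd ℂ κ * zc / (1 + starRingEnd ℂ κ) := by
    simp [ha, hzc]
  have hEc : starRingEnd ℂ E = (h + κ * U) / (1 + κ) := by
    simp [hE, hW]
  set κc := starRingEnd ℂ κ with hκc'
  have hnull : (1 + κc) * (h + κ * U) + (1 + κ) * (h + κc * W) - 2 * κ * κc * (z * zc) = 0 := by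
    rw [hzz, hκc, hκ]
    linear_combination 2 * hcC + (2 * c + c ^ 2 * (U + W) - 2 * c ^ 2 * Complex.normSq z) * hnorm
      + c ^ 2 * m * hUU + (by push_cast; ring : (c : ℂ) ^ 2 * m * (2 * ((η + Complex.normSq z : ℝ) : ℂ))
        = 2 * c ^ 2 * m * (η + Complex.normSq z))
  have hEa : E.re = Complex.normSq a := by
    have : ((2 * E.re : ℝ) : ℂ) = ((2 * Complex.normSq a : ℝ) : ℂ) := by
      rw [← Complex.add_conj, hEc]
      push_cast
      rw [← Complex.mul_conj, hac, ha, hE]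
      field_simp
      linear_combination hnull
    have := Complex.ofReal_injective this
    linarith
  have hP : (h : ℂ) + E ≠ 0 := by
    intro h0
    have := congrArg Complex.re h0
    simp at this
    have := Complex.normSq_nonneg a
    linarith
  have hPD : ((h : ℂ) + E) * (1 + κc) = ((2 * h + c * m : ℝ) : ℂ) := by
    rw [hE]
    field_simp
    rw [hκc]
    push_cast
    linear_combination c * hnorm
  -- The two U-coordinates after the translation have quotient -κ; this is again the nullness of p +
  -- κq, and both remaining claims follow from it.
  have hPQ : (h : ℂ) + E + κ * (U + E + 2 * starRingEnd ℂ a * z) = 0 := by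
    rw [hac, hE]
    field_simp
    linear_combination hnull
  refine ⟨a, E, hEa, ?_, ?_⟩
  · have hza : z + a = z / (1 + κ) := by rw [ha]; field_simp; ring
    have h1 : a * (1 + κ) = -κ * z := by rw [ha]; field_simp
    have h2 : z / (1 + κ) * (1 + κ) = z := by field_simp
    rw [hza]
    apply mul_right_cancel₀ hD
    linear_combination (U + E + 2 * starRingEnd ℂ a * z) * h1 - (h + E) * h2 - z * hPQ
  · have hκ0 : κ ≠ 0 := by
      intro h0; rw [h0] at hPQ; apply hP; simpa using hPQ
    have hQ : U + E + 2 * starRingEnd ℂ a * z = -(h + E) / κ := by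
      field_simp
      linear_combination hPQ
    have hr : (((h : ℂ) + E)⁻¹ - (-(h + E) / κ)⁻¹)
        = ((Complex.normSq (1 + κ) / (2 * h + c * m) : ℝ) : ℂ) := by
      push_cast [← hPD]
      rw [← Complex.mul_conj]
      have : starRingEnd ℂ (1 + κ) = 1 + κc := by simp [hκc']
      rw [this]
      field_simp
      ring
    rw [hQ, hr, Complex.ofReal_im]

/-- Two points over the same boundary point lie on a translate of the vertical geodesic. -/
theorem exists_isometryPair_of_eq {p q : Fin 4 → ℝ} (hp : 0 < p 0) (hq : 0 < q 0)
    (h1 : p 1 = q 1) (h2 : p 2 = q 2) (h3 : p 3 = q 3) :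
    ∃ Φ Ψ, IsIsometryPair Φ Ψ ∧ ∃ s₁ s₂, s₁ ≤ s₂ ∧ Ψ p = vert s₁ ∧ Ψ q = vert s₂ := by
  have key (x : Fin 4 → ℝ) (hx : 0 < x 0) (e1 : x 1 = q 1) (e2 : x 2 = q 2) (e3 : x 3 = q 3) :
      translation (-q 1) (-q 2) (-q 3) x = vert (Real.log (x 0)) := by
    ext k
    fin_cases k <;> simp [translation, vert, Real.exp_log hx, e1, e2, e3]
    ring
  have hT := (isIsometryPair_translation (q 1) (q 2) (q 3))
  rcases le_total (Real.log (p 0)) (Real.log (q 0)) with hle | hle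
  · exact ⟨_, _, hT, _, _, hle, key p hp h1 h2 h3, key q hq rfl rfl rfl⟩
  -- If `p` lies above `q`, the inversion, which acts on the vertical line by s ↦ -s, restores the
  -- order.
  · refine ⟨_, _, hT.trans isIsometryPair_inversion, _, _, neg_le_neg hle, ?_, ?_⟩
    · simp [key p hp h1 h2 h3, inversion_vert]
    · simp [key q hq rfl rfl rfl, inversion_vert]

theorem exists_isometryPair_trans {Φ Ψ : (Fin 4 → ℝ) → Fin 4 → ℝ} (h : IsIsometryPair Φ Ψ)
    {p q : Fin 4 → ℝ} (hpq : ∃ Φ Ψ', IsIsometryPair Φ Ψ' ∧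
      ∃ s₁ s₂, s₁ ≤ s₂ ∧ Ψ' (Ψ p) = vert s₁ ∧ Ψ' (Ψ q) = vert s₂) :
    ∃ Φ Ψ, IsIsometryPair Φ Ψ ∧ ∃ s₁ s₂, s₁ ≤ s₂ ∧ Ψ p = vert s₁ ∧ Ψ q = vert s₂ := by
  obtain ⟨Φ', Ψ', h', s₁, s₂, hs, e1, e2⟩ := hpq
  exact ⟨_, _, h.trans h', s₁, s₂, hs, e1, e2⟩

/-- A translation brings an end point at infinity of the geodesic to the origin and the inversion
sends it to ∞. The geodesic is then vertical: the images of the two points share z and Im U, which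
is the case of `exists_isometryPair_of_eq`. -/
theorem exists_isometryPair_of_axis {h : ℝ} (hh : 0 < h) {q : Fin 4 → ℝ} (hq : 0 < q 0) :
    ∃ Φ Ψ, IsIsometryPair Φ Ψ ∧ ∃ s₁ s₂, s₁ ≤ s₂ ∧ Ψ ![h, 0, 0, 0] = vert s₁ ∧
      Ψ q = vert s₂ := by
  set p : Fin 4 → ℝ := ![h, 0, 0, 0] with hp
  have hp0 : 0 < p 0 := by simpa [hp] using hh
  by_cases hv : coordZ q = 0 ∧ (coordU q).im = 0
  · have h3 : q 3 = 0 := congrArg Complex.re hv.1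
    have h2 : q 2 = 0 := congrArg Complex.im hv.1
    have h1 : q 1 = 0 := by simpa [coordU] using hv.2
    exact exists_isometryPair_of_eq hp0 hq (by simp [hp, h1]) (by simp [hp, h2])
      (by simp [hp, h3])
  have hU : (coordU q).re = q 0 + Complex.normSq (coordZ q) := by
    simp [coordU, coordZ, Complex.normSq_apply]; ring
  obtain ⟨a, E, hE, hZ, hI⟩ := exists_translation_data hh hq hU hv
  -- The inverse of this translation is the one that adds a to z; the double negations below are the
  -- form in which that inverse is given.
  have hT := (isIsometryPair_translation (E.im) (-a.im) (-a.re))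
  have hTU (x : Fin 4 → ℝ) : coordU (translation (-E.im) (- -a.im) (- -a.re) x)
      = coordU x + E + 2 * starRingEnd ℂ a * coordZ x := by
    rw [coordU_translation]
    have e1 : (⟨(- -a.re) ^ 2 + (- -a.im) ^ 2, - -E.im⟩ : ℂ) = E := by
      apply Complex.ext
      · simp [hE, Complex.normSq_apply]; ring
      · simp
    have e2 : (⟨- -a.re, - -a.im⟩ : ℂ) = a := by apply Complex.ext <;> simp
    rw [e1, e2]
  have hTZ (x : Fin 4 → ℝ) : coordZ (translation (-E.im) (- -a.im) (- -a.re) x)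
      = coordZ x + a := by
    rw [coordZ_translation]
    congr 1
    apply Complex.ext <;> simp
  have hpU : coordU p = h := by apply Complex.ext <;> simp [coordU, hp]
  have hpZ : coordZ p = 0 := by apply Complex.ext <;> simp [coordZ, hp]
  refine exists_isometryPair_trans hT (exists_isometryPair_trans isIsometryPair_inversion ?_)
  have hTp := hT.right.pos p hp0
  have hTq := hT.right.pos q hq
  have hPU := hTU p
  have hQU := hTU q
  have hPZ := hTZ p
  have hQZ := hTZ q
  set p' := translation (-E.im) (- -a.im) (- -a.re) p
  set q' := translation (-E.im) (- -a.im) (- -a.re) q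
  rw [hpU, hpZ, mul_zero, add_zero] at hPU
  rw [hpZ, zero_add] at hPZ
  have hp'0 := coordU_ne_zero hTp
  have hq'0 := coordU_ne_zero hTq
  rw [← hPU, ← hQU] at hZ hI
  rw [← hPZ, ← hQZ.trans (congrArg _ hPZ.symm)] at hZ
  have hz : coordZ (inversion p') = coordZ (inversion q') := by
    rw [coordZ_inversion, coordZ_inversion, div_eq_div_iff hp'0 hq'0, hZ]
  have hu : (coordU (inversion p') - coordU (inversion q')).im = 0 := by
    rw [coordU_inversion hTp, coordU_inversion hTq, hI]
  refine exists_isometryPair_of_eq (isMetricMap_inversion.pos _ hTp)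
    (isMetricMap_inversion.pos _ hTq) ?_ (congrArg Complex.im hz) (congrArg Complex.re hz)
  simp [coordU] at hu
  linarith

/-- Any two points lie, in order, on the image of the vertical geodesic under an isometry. -/
theorem exists_isometryPair {p q : Fin 4 → ℝ} (hp : 0 < p 0) (hq : 0 < q 0) :
    ∃ Φ Ψ, IsIsometryPair Φ Ψ ∧ ∃ s₁ s₂, s₁ ≤ s₂ ∧ Ψ p = vert s₁ ∧ Ψ q = vert s₂ := by
  have hT := isIsometryPair_translation (p 1) (p 2) (p 3)
  refine exists_isometryPair_trans hT ?_
  have hTp : translation (-p 1) (-p 2) (-p 3) p = ![p 0, 0, 0, 0] := by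
    ext k; fin_cases k <;> simp [translation]; ring
  rw [hTp]
  exact exists_isometryPair_of_axis hp (hT.right.pos q hq)

/-! ### Geodesics -/

theorem gH_comm (x v w : Fin 4 → ℝ) : gH x v w = gH x w v := by
  unfold gH; ring

theorem gComp_comm (i j : Fin 4) (x : Fin 4 → ℝ) : gComp i j x = gComp j i x := gH_comm _ _ _

theorem gH_eq_sum (x v w : Fin 4 → ℝ) : gH x v w = ∑ i, ∑ j, v i * w j * gComp i j x := by
  simp [Fin.sum_univ_four, gComp, gH, contactForm, coordVec, Pi.single_apply]
  ring

theorem gH_add_smul (x v w : Fin 4 → ℝ) (ε : ℝ) :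
    gH x (v + ε • w) (v + ε • w) = gH x v v + 2 * ε * gH x v w + ε ^ 2 * gH x w w := by
  simp [gH, contactForm]
  ring

theorem differentiableAt_gComp (i j : Fin 4) {x : Fin 4 → ℝ} (hx : 0 < x 0) :
    DifferentiableAt ℝ (gComp i j) x := by
  have h1 : x 0 ≠ 0 := hx.ne'
  have h2 : x 0 ^ 2 ≠ 0 := pow_ne_zero 2 h1
  unfold gComp gH contactForm
  fun_prop (disch := assumption)

theorem eq_zero_of_forall_quadratic {B C : ℝ} (h : ∀ ε : ℝ, 0 ≤ ε * B + ε ^ 2 * C) : B = 0 := by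
  by_contra hB
  have hC : 0 < |C| + 1 := by positivity
  -- A step of size B / (|C| + 1) against the linear term is short enough for the linear term to
  -- dominate.
  have h1 := h (-B / (|C| + 1))
  have h2 : -B / (|C| + 1) * B + (-B / (|C| + 1)) ^ 2 * C
      = -(B ^ 2 / (|C| + 1) ^ 2) * (|C| + 1 - C) := by
    field_simp
    ring
  rw [h2] at h1
  have h3 : 0 < |C| + 1 - C := by linarith [le_abs_self C]
  have : 0 < B ^ 2 / (|C| + 1) ^ 2 * (|C| + 1 - C) := by positivity
  linarith

/-- A unit speed curve along which a calibrating function `b` (one with `db² ≤ g_H`) grows with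
unit speed is a geodesic. -/
theorem isUnitSpeedGeodesic_of_calibration {ξ : ℝ → Fin 4 → ℝ} (hξ : ContDiff ℝ ∞ ξ)
    (hpos : ∀ s, 0 < ξ s 0) (hunit : ∀ s, gH (ξ s) (deriv ξ s) (deriv ξ s) = 1)
    {b : (Fin 4 → ℝ) → ℝ} (hb : ∀ x, 0 < x 0 → ContDiffAt ℝ ∞ b x)
    (hle : ∀ x v, 0 < x 0 → fderiv ℝ b x v ^ 2 ≤ gH x v v)
    (hbξ : ∀ s, fderiv ℝ b (ξ s) (deriv ξ s) = 1) : IsUnitSpeedGeodesic ξ := by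
  refine ⟨hξ, hpos, hunit, fun s k => ?_⟩
  have hξd (s : ℝ) : HasDerivAt ξ (deriv ξ s) s :=
    (hξ.differentiable (by simp) s).hasDerivAt
  have hξ' : ContDiff ℝ ∞ (deriv ξ) := hξ.deriv'
  have hξdd (s : ℝ) : HasDerivAt (deriv ξ) (deriv (deriv ξ) s) s :=
    (hξ'.differentiable (by simp) s).hasDerivAt
  -- The form g - db² is nonnegative and vanishes on ξ', so ξ' lies in its kernel: b has gradient ξ'
  -- along ξ.
  have hA (s : ℝ) (w : Fin 4 → ℝ) : gH (ξ s) (deriv ξ s) w = fderiv ℝ b (ξ s) w := by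
    have h := eq_zero_of_forall_quadratic
      (B := 2 * (gH (ξ s) (deriv ξ s) w - fderiv ℝ b (ξ s) w))
      (C := gH (ξ s) w w - fderiv ℝ b (ξ s) w ^ 2) fun ε => by
        have h1 := hle (ξ s) (deriv ξ s + ε • w) (hpos s)
        rw [gH_add_smul, hunit, map_add, map_smul, hbξ, smul_eq_mul] at h1
        linarith
    linarith
  have hb2 : ∀ x, 0 < x 0 → DifferentiableAt ℝ (fderiv ℝ b) x := fun x hx =>
    ((hb x hx).fderiv_right (m := ∞) (by simp)).differentiableAt (by simp)
  set x := ξ s with hx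
  set v := deriv ξ s with hv
  set u := deriv (deriv ξ) s with hu
  set H := fderiv ℝ (fderiv ℝ b) x with hH
  have hsymm : H v (coordVec k) = H (coordVec k) v :=
    ((hb x (hpos s)).isSymmSndFDerivAt (by simp; exact WithTop.coe_le_coe.2 (le_top : (2 : ℕ∞) ≤ ⊤))) v (coordVec k)
  have hG (i j : Fin 4) : HasFDerivAt (gComp i j) (fderiv ℝ (gComp i j) x) x :=
    (differentiableAt_gComp i j (hpos s)).hasFDerivAt
  -- The identity g(ξ', e_k) = ∂_k b, differentiated along ξ.
  have hC : ∑ i, (u i * gComp i k x + v i * fderiv ℝ (gComp i k) x v) = H v (coordVec k) := by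
    have h1 : HasDerivAt (fun s => ∑ i, deriv ξ s i * gComp i k (ξ s))
        (∑ i, (u i * gComp i k x + v i * fderiv ℝ (gComp i k) x v)) s := by
      refine HasDerivAt.fun_sum fun i _ => ?_
      exact (hasDerivAt_pi.1 (hξdd s) i).fun_mul ((hG i k).comp_hasDerivAt s (hξd s))
    have h2 : HasDerivAt (fun s => fderiv ℝ b (ξ s) (coordVec k)) (H v (coordVec k)) s := by
      have h3 := ((hb2 x (hpos s)).hasFDerivAt.comp_hasDerivAt s (hξd s))
      simpa using h3.clm_apply (hasDerivAt_const s (coordVec k))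
    refine h1.unique (h2.congr_of_eventuallyEq (Eventually.of_forall fun s => ?_))
    simp only
    rw [← hA s, gH_eq_sum]
    simp [coordVec, Pi.single_apply, Fin.sum_univ_four]
  -- With v frozen, x ↦ g_x(v, v) - (db_x v)² has a minimum, zero, at ξ(s), so its k-th partial
  -- derivative vanishes there. As the Hessian of b is symmetric, half of this subtracted from `hC`
  -- is the geodesic equation.
  have hB : ∑ i, ∑ j, v i * v j * fderiv ℝ (gComp i j) x (coordVec k)
      = 2 * H (coordVec k) v := by
    have hl : HasDerivAt (fun ε : ℝ => x + ε • coordVec k) (coordVec k) 0 := by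
      simpa using ((hasDerivAt_id (0 : ℝ)).smul_const (coordVec k)).const_add x
    have hl0 : x + (0 : ℝ) • coordVec k = x := by simp
    have h1 : HasDerivAt (fun ε : ℝ => ∑ i, ∑ j, v i * v j * gComp i j (x + ε • coordVec k))
        (∑ i, ∑ j, v i * v j * fderiv ℝ (gComp i j) x (coordVec k)) 0 := by
      refine HasDerivAt.fun_sum fun i _ => HasDerivAt.fun_sum fun j _ => ?_
      have h := hG i j
      rw [← hl0] at h
      have := (h.comp_hasDerivAt (0 : ℝ) hl).const_mul (v i * v j)
      rwa [hl0] at this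
    have h2 : HasDerivAt (fun ε : ℝ => fderiv ℝ b (x + ε • coordVec k) v)
        (H (coordVec k) v) 0 := by
      have h := (hb2 x (hpos s)).hasFDerivAt
      rw [← hl0] at h
      have h3 := h.comp_hasDerivAt (0 : ℝ) hl
      rw [hl0] at h3
      simpa using h3.clm_apply (hasDerivAt_const (0 : ℝ) v)
    have h3 := h1.fun_sub (h2.fun_pow 2)
    have hmin : IsLocalMin (fun ε : ℝ => ∑ i, ∑ j, v i * v j * gComp i j (x + ε • coordVec k)
        - fderiv ℝ b (x + ε • coordVec k) v ^ 2) 0 := by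
      have hc : ContinuousAt (fun ε : ℝ => (x + ε • coordVec k) 0) 0 := by fun_prop
      have : ∀ᶠ ε in 𝓝 (0 : ℝ), 0 < (x + ε • coordVec k) 0 :=
        hc.eventually (lt_mem_nhds (by simpa [hx] using hpos s))
      filter_upwards [this] with ε hε
      simp only [hl0]
      rw [← gH_eq_sum, ← gH_eq_sum]
      have h4 := hle _ v hε
      have h5 : gH x v v = 1 := hunit s
      have h6 : fderiv ℝ b x v = 1 := hbξ s
      rw [h5, h6]
      linarith
    have h7 := hmin.hasDerivAt_eq_zero h3
    have h6 : fderiv ℝ b x v = 1 := hbξ s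
    rw [hl0, h6] at h7
    norm_num at h7
    linarith
  have hlin (i j : Fin 4) : fderiv ℝ (gComp i j) x v = ∑ l, v l * fderiv ℝ (gComp i j) x (coordVec l) := by
    have : v = ∑ l, v l • coordVec l := by
      ext m; simp [coordVec, Finset.sum_apply, Pi.single_apply]
    conv_lhs => rw [this]
    simp
  simp only [hlin] at hC
  rw [hsymm] at hC
  simp only [christoffel, partialD]
  have hsw : ∑ j, gComp k j x * u j = ∑ j, u j * gComp j k x :=
    Finset.sum_congr rfl fun j _ => by rw [gComp_comm, mul_comm]
  rw [hsw]
  simp only [Fin.sum_univ_four] at hC hB ⊢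
  linear_combination hC - hB / 2

/-- The calibrating function of the image of the vertical geodesic under the inverse of `Ψ`. -/
theorem contDiffAt_log_apply {Ψ : (Fin 4 → ℝ) → Fin 4 → ℝ} (h : IsMetricMap Ψ) {x : Fin 4 → ℝ}
    (hx : 0 < x 0) : ContDiffAt ℝ ∞ (fun x => Real.log (Ψ x 0)) x :=
  (contDiffAt_pi.1 (h.smooth x hx) 0).log (h.pos x hx).ne'

theorem fderiv_log_apply {Ψ : (Fin 4 → ℝ) → Fin 4 → ℝ} (h : IsMetricMap Ψ) {x : Fin 4 → ℝ}
    (hx : 0 < x 0) (v : Fin 4 → ℝ) :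
    fderiv ℝ (fun x => Real.log (Ψ x 0)) x v = fderiv ℝ Ψ x v 0 / Ψ x 0 := by
  have h1 : HasFDerivAt (fun x => Ψ x 0)
      ((ContinuousLinearMap.proj (R := ℝ) (φ := fun _ : Fin 4 => ℝ) 0).comp (fderiv ℝ Ψ x)) x :=
    hasFDerivAt_pi'.1 (h.differentiableAt hx).hasFDerivAt 0
  rw [(h1.log (h.pos x hx).ne').fderiv]
  simp
  field_simp

/-- The left side is the first of the three nonnegative terms of g_H. This is the calibration
inequality for log η, from which all minimality statements derive. -/
theorem sq_le_gH {x : Fin 4 → ℝ} (hx : 0 < x 0) (v : Fin 4 → ℝ) :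
    (v 0 / x 0) ^ 2 ≤ gH x v v := by
  unfold gH
  have h2 := mul_self_nonneg (contactForm x v)
  have h3 := mul_self_nonneg (v 3)
  have h4 := mul_self_nonneg (v 2)
  rw [show (v 0 / x 0) ^ 2 = v 0 * v 0 / x 0 ^ 2 by ring, add_assoc]
  exact le_add_of_nonneg_right (by positivity)

theorem hasDerivAt_comp_vert {Φ : (Fin 4 → ℝ) → Fin 4 → ℝ} (h : IsMetricMap Φ) (s : ℝ) :
    HasDerivAt (fun s => Φ (vert s)) (fderiv ℝ Φ (vert s) ![Real.exp s, 0, 0, 0]) s :=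
  (h.differentiableAt (vert_pos s)).hasFDerivAt.comp_hasDerivAt s (hasDerivAt_vert s)

theorem gH_vert (s : ℝ) : gH (vert s) ![Real.exp s, 0, 0, 0] ![Real.exp s, 0, 0, 0] = 1 := by
  have := (Real.exp_pos s).ne'
  simp [gH, vert, contactForm]
  field_simp

theorem contDiff_comp_vert {Φ : (Fin 4 → ℝ) → Fin 4 → ℝ} (h : IsMetricMap Φ) :
    ContDiff ℝ ∞ (fun s => Φ (vert s)) :=
  contDiff_iff_contDiffAt.2 fun s =>
    (h.smooth _ (vert_pos s)).comp s contDiff_vert.contDiffAt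

/-- The curve is calibrated by log of the η-coordinate of Ψ: the calibration inequality is
transported by the isometry, and along the curve Ψ undoes Φ, so the function equals s. -/
theorem IsIsometryPair.isUnitSpeedGeodesic {Φ Ψ : (Fin 4 → ℝ) → Fin 4 → ℝ}
    (h : IsIsometryPair Φ Ψ) : IsUnitSpeedGeodesic (fun s => Φ (vert s)) := by
  refine isUnitSpeedGeodesic_of_calibration (contDiff_comp_vert h.left)
    (fun s => h.left.pos _ (vert_pos s)) (fun s => ?_)
    (fun x hx => contDiffAt_log_apply h.right hx) (fun x v hx => ?_) (fun s => ?_)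
  · rw [(hasDerivAt_comp_vert h.left s).deriv, h.left.metric _ _ (vert_pos s), gH_vert]
  · rw [fderiv_log_apply h.right hx, ← h.right.metric x v hx]
    exact sq_le_gH (h.right.pos x hx) _
  · have hx := h.left.pos _ (vert_pos s)
    have hb := ((contDiffAt_log_apply h.right hx).differentiableAt (by simp)).hasFDerivAt
    have hξ := (contDiff_comp_vert h.left |>.differentiable (by simp) s).hasDerivAt
    have h1 := hb.comp_hasDerivAt s hξ
    refine h1.unique ?_
    have h2 : (fun x => Real.log (Ψ x 0)) ∘ (fun s => Φ (vert s)) = id := by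
      funext s
      simp only [Function.comp_apply]
      rw [h.left_inv _ (vert_pos s)]
      simp [vert]
    rw [h2]
    exact hasDerivAt_id s

open MeasureTheory

/-! ### Absolutely continuous curves -/

/-- The sup distance is at most the sum of the coordinate distances, so the finitely many coordinate
variations control the variation of the curve. -/
theorem absolutelyContinuousOnInterval_pi {ι : Type*} [Fintype ι] {ζ : ℝ → ι → ℝ} {a b : ℝ}
    (h : ∀ k, AbsolutelyContinuousOnInterval (fun t => ζ t k) a b) :
    AbsolutelyContinuousOnInterval ζ a b := by
  refine squeeze_zero (fun E => Finset.sum_nonneg fun i _ => dist_nonneg) (fun E => ?_)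
    (by simpa using tendsto_finsetSum Finset.univ fun k _ => h k)
  rw [Finset.sum_comm]
  refine Finset.sum_le_sum fun i _ => (dist_pi_le_iff ?_).2 fun k => ?_
  · exact Finset.sum_nonneg fun _ _ => dist_nonneg
  · exact Finset.single_le_sum (f := fun k => dist (ζ (E.2 i).1 k) (ζ (E.2 i).2 k))
      (fun _ _ => dist_nonneg) (Finset.mem_univ k)

theorem _root_.LipschitzOnWith.comp_absolutelyContinuousOnInterval {X Y : Type*}
    [PseudoMetricSpace X] [PseudoMetricSpace Y] {F : X → Y} {s : Set X} {K : NNReal}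
    (hF : LipschitzOnWith K F s) {ζ : ℝ → X} {a b : ℝ}
    (hζ : AbsolutelyContinuousOnInterval ζ a b) (hs : MapsTo ζ (uIcc a b) s) :
    AbsolutelyContinuousOnInterval (fun t => F (ζ t)) a b := by
  refine squeeze_zero' (Eventually.of_forall fun E => Finset.sum_nonneg fun i _ => dist_nonneg) ?_
    (by simpa using Tendsto.const_mul (K : ℝ) hζ)
  rw [eventually_inf_principal]
  refine Eventually.of_forall fun E hE => ?_
  rw [Finset.mul_sum]
  exact Finset.sum_le_sum fun i hi =>
    hF.dist_le_mul _ (hs (hE.1 i hi).1) _ (hs (hE.1 i hi).2)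

/-- A `C¹` function of an absolutely continuous curve in `{η > 0}` is absolutely continuous. -/
theorem absolutelyContinuousOnInterval_comp {F : (Fin 4 → ℝ) → ℝ}
    (hF : ∀ x, 0 < x 0 → ContDiffAt ℝ 1 F x) {ζ : ℝ → Fin 4 → ℝ} {a b : ℝ}
    (hζ : ∀ k, AbsolutelyContinuousOnInterval (fun t => ζ t k) a b)
    (hpos : ∀ t ∈ uIcc a b, 0 < ζ t 0) :
    AbsolutelyContinuousOnInterval (fun t => F (ζ t)) a b := by
  have hac := absolutelyContinuousOnInterval_pi hζ
  obtain ⟨M, hM⟩ := hac.exists_bound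
  -- The η-coordinate has a positive minimum on the interval, so the curve stays in a compact convex
  -- subset of {η > 0}, on which a C¹ function is Lipschitz.
  obtain ⟨t₀, ht₀, hmin⟩ := isCompact_uIcc.exists_isMinOn nonempty_uIcc (hζ 0).continuousOn
  set S : Set (Fin 4 → ℝ) := Metric.closedBall 0 M ∩ {x | ζ t₀ 0 ≤ x 0}
  have hS : IsCompact S := (isCompact_closedBall 0 M).inter_right
    (isClosed_le continuous_const (continuous_apply 0))
  have hSc : Convex ℝ S := (convex_closedBall 0 M).inter
    (convex_halfSpace_ge (LinearMap.proj (R := ℝ) (φ := fun _ : Fin 4 => ℝ) 0).isLinear _)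
  obtain ⟨K, hK⟩ := ContDiffOn.exists_lipschitzOnWith
    (fun x hx => (hF x ((hpos t₀ ht₀).trans_le hx.2)).contDiffWithinAt) (by decide) hSc hS
  exact hK.comp_absolutelyContinuousOnInterval hac
    fun t ht => ⟨by simpa using hM t ht, hmin ht⟩

theorem ae_differentiableAt_of_ac {ζ : ℝ → Fin 4 → ℝ} {a b : ℝ}
    (hζ : ∀ k, AbsolutelyContinuousOnInterval (fun t => ζ t k) a b) :
    ∀ᵐ x, x ∈ uIcc a b → DifferentiableAt ℝ ζ x := by
  filter_upwards [ae_all_iff.2 fun k => (hζ k).ae_differentiableAt] with x hx hxm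
  exact differentiableAt_pi.2 fun k => hx k hxm

theorem ae_mem_Ioo_of_mem_uIcc {a b : ℝ} (hab : a < b) :
    ∀ᵐ x : ℝ, x ∈ uIcc a b → x ∈ Ioo a b := by
  filter_upwards [ae_iff.2 (by simp : volume {x : ℝ | ¬ x ≠ a} = 0),
    ae_iff.2 (by simp : volume {x : ℝ | ¬ x ≠ b} = 0)] with x h1 h2 h3
  rw [uIcc_of_le hab.le] at h3
  exact ⟨lt_of_le_of_ne h3.1 h1.symm, lt_of_le_of_ne h3.2 h2⟩

theorem vert_apply_of_ne (s : ℝ) {k : Fin 4} (hk : k ≠ 0) : vert s k = 0 := by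
  fin_cases k
  exacts [absurd rfl hk, rfl, rfl, rfl]

/-! ### The weighted energy `∫ w g_H(ζ', ζ') dx` -/

theorem gH_comp {Ψ : (Fin 4 → ℝ) → Fin 4 → ℝ} (h : IsMetricMap Ψ) {ζ : ℝ → Fin 4 → ℝ} {x : ℝ}
    (hd : DifferentiableAt ℝ ζ x) (hpos : 0 < ζ x 0) :
    HasDerivAt (fun x => Ψ (ζ x)) (fderiv ℝ Ψ (ζ x) (deriv ζ x)) x ∧
      gH (Ψ (ζ x)) (fderiv ℝ Ψ (ζ x) (deriv ζ x)) (fderiv ℝ Ψ (ζ x) (deriv ζ x))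
        = gH (ζ x) (deriv ζ x) (deriv ζ x) :=
  ⟨(h.differentiableAt hpos).hasFDerivAt.comp_hasDerivAt x hd.hasDerivAt, h.metric _ _ hpos⟩

/-- The integrand of the weighted energy of `x ↦ Φ(vert(α τ(x) + β))`, where `τ' = 1 / w`. -/
theorem weighted_density_eq {Φ : (Fin 4 → ℝ) → Fin 4 → ℝ} (h : IsMetricMap Φ) {w τ : ℝ → ℝ}
    {ζ : ℝ → Fin 4 → ℝ} {a b α β : ℝ} (hwpos : ∀ x ∈ Ioo a b, 0 < w x)
    (hτ : ∀ x ∈ Ioo a b, HasDerivAt τ (1 / w x) x)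
    (hζ : EqOn ζ (fun x => Φ (vert (α * τ x + β))) (Ioo a b)) {x : ℝ} (hx : x ∈ Ioo a b) :
    w x * gH (ζ x) (deriv ζ x) (deriv ζ x) = α ^ 2 * (1 / w x) := by
  have h1 : HasDerivAt (fun x => α * τ x + β) (α * (1 / w x)) x :=
    ((hτ x hx).const_mul α).add_const β
  have h2 := (hasDerivAt_comp_vert h (α * τ x + β)).scomp x h1
  have h3 : ζ =ᶠ[𝓝 x] (fun x => Φ (vert (α * τ x + β))) :=
    hζ.eventuallyEq_of_mem (Ioo_mem_nhds hx.1 hx.2)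
  rw [h3.deriv_eq, hζ hx]
  erw [h2.deriv]
  -- Adding 0 lets the scaling of g_H be read off from `gH_add_smul`.
  rw [← zero_add ((α * (1 / w x)) • _)]
  have hq (p v : Fin 4 → ℝ) (c : ℝ) : gH p (0 + c • v) (0 + c • v) = c ^ 2 * gH p v v := by
    rw [gH_add_smul]
    simp [gH, contactForm]
  rw [hq, h.metric _ _ (vert_pos _), gH_vert]
  have := (hwpos x hx).ne'
  field_simp

theorem weighted_energy_eq {Φ : (Fin 4 → ℝ) → Fin 4 → ℝ} (h : IsMetricMap Φ) {w τ : ℝ → ℝ}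
    {ζ : ℝ → Fin 4 → ℝ} {a b α β : ℝ} (hab : a < b) (hw : ContinuousOn w (Icc a b))
    (hwpos : ∀ x ∈ Icc a b, 0 < w x) (hτc : ContinuousOn τ (Icc a b))
    (hτ : ∀ x ∈ Ioo a b, HasDerivAt τ (1 / w x) x)
    (hζ : EqOn ζ (fun x => Φ (vert (α * τ x + β))) (Ioo a b)) :
    IntervalIntegrable (fun x => w x * gH (ζ x) (deriv ζ x) (deriv ζ x)) volume a b ∧
      ∫ x in a..b, w x * gH (ζ x) (deriv ζ x) (deriv ζ x) = α ^ 2 * (τ b - τ a) := by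
  have hint : IntervalIntegrable (fun x => 1 / w x) volume a b := by
    refine ContinuousOn.intervalIntegrable ?_
    rw [uIcc_of_le hab.le]
    exact continuousOn_const.div hw fun x hx => (hwpos x hx).ne'
  have hae : ∀ᵐ x, x ∈ uIoc a b →
      α ^ 2 * (1 / w x) = w x * gH (ζ x) (deriv ζ x) (deriv ζ x) := by
    filter_upwards [ae_mem_Ioo_of_mem_uIcc hab] with x hx hxm
    exact (weighted_density_eq h (fun x hx => hwpos x (Ioo_subset_Icc_self hx)) hτ hζ
      (hx (uIoc_subset_uIcc hxm))).symm
  refine ⟨(hint.const_mul (α ^ 2)).congr_ae ((ae_restrict_iff' measurableSet_uIoc).2 hae), ?_⟩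
  rw [← intervalIntegral.integral_congr_ae hae, intervalIntegral.integral_const_mul,
    intervalIntegral.integral_eq_sub_of_hasDerivAt_of_le hab.le hτc hτ hint]

/-- The image of the vertical geodesic is the unique minimizer of the weighted energy. -/
theorem weighted_energy_lower_bound {Φ Ψ : (Fin 4 → ℝ) → Fin 4 → ℝ} (h : IsIsometryPair Φ Ψ)
    {w τ : ℝ → ℝ} {ζ : ℝ → Fin 4 → ℝ} {a b α β : ℝ} (hab : a < b)
    (hwpos : ∀ x ∈ Icc a b, 0 < w x) (hτc : ContDiffOn ℝ 1 τ (Icc a b))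
    (hτ : ∀ x ∈ Ioo a b, HasDerivAt τ (1 / w x) x)
    (hac : ∀ k, AbsolutelyContinuousOnInterval (fun t => ζ t k) a b)
    (hpos : ∀ t ∈ Icc a b, 0 < ζ t 0)
    (hint : IntervalIntegrable (fun x => w x * gH (ζ x) (deriv ζ x) (deriv ζ x)) volume a b)
    (ha : Ψ (ζ a) = vert (α * τ a + β)) (hb : Ψ (ζ b) = vert (α * τ b + β)) :
    α ^ 2 * (τ b - τ a) ≤ ∫ x in a..b, w x * gH (ζ x) (deriv ζ x) (deriv ζ x) ∧
    (∫ x in a..b, w x * gH (ζ x) (deriv ζ x) (deriv ζ x) ≤ α ^ 2 * (τ b - τ a) →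
      ∀ x ∈ Icc a b, ζ x = Φ (vert (α * τ x + β))) := by
  have hpos' : ∀ t ∈ uIcc a b, 0 < ζ t 0 := by rwa [uIcc_of_le hab.le]
  have hy (k : Fin 4) : AbsolutelyContinuousOnInterval (fun t => Ψ (ζ t) k) a b :=
    absolutelyContinuousOnInterval_comp (F := fun x => Ψ x k)
      (fun x hx => (contDiffAt_pi.1 (h.right.smooth x hx) k).of_le (by simp)) hac hpos'
  have hL : AbsolutelyContinuousOnInterval (fun t => Real.log (Ψ (ζ t) 0)) a b :=
    absolutelyContinuousOnInterval_comp (F := fun x => Real.log (Ψ x 0))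
      (fun x hx => (contDiffAt_log_apply h.right hx).of_le (by simp)) hac hpos'
  have hτac : AbsolutelyContinuousOnInterval τ a b := by
    rw [← uIcc_of_le hab.le] at hτc
    exact hτc.absolutelyContinuousOnInterval
  set L := fun t => Real.log (Ψ (ζ t) 0) with hLdef
  have hLa : L a = α * τ a + β := by simp [hLdef, ha, vert]
  have hLb : L b = α * τ b + β := by simp [hLdef, hb, vert]
  set I := ∫ x in a..b, w x * gH (ζ x) (deriv ζ x) (deriv ζ x) with hI
  -- Subtracting 2αL' - α²τ' completes the square. By the boundary values L increases by α(τ(b) -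
  -- τ(a)), so the subtracted terms integrate to α²(τ(b) - τ(a)) for every competitor.
  set N := fun x => w x * gH (ζ x) (deriv ζ x) (deriv ζ x) - 2 * α * deriv L x
    + α ^ 2 * deriv τ x with hN
  have hi1 := hL.intervalIntegrable_deriv.const_mul (2 * α)
  have hi2 := hτac.intervalIntegrable_deriv.const_mul (α ^ 2)
  have hNint : IntervalIntegrable N volume a b := (hint.sub hi1).add hi2
  have hNI : ∫ x in a..b, N x = I - α ^ 2 * (τ b - τ a) := by
    rw [hN, intervalIntegral.integral_add (hint.sub hi1) hi2,
      intervalIntegral.integral_sub hint hi1, intervalIntegral.integral_const_mul,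
      intervalIntegral.integral_const_mul, hL.integral_deriv_eq_sub,
      hτac.integral_deriv_eq_sub, hLa, hLb]
    ring
  -- As τ' = 1/w, the density becomes w times a sum of squares: the radial part of the speed is
  -- compared with α/w and the other parts with 0.
  have hae : ∀ᵐ x, x ∈ uIcc a b → x ∈ Ioo a b ∧ ∃ v : Fin 4 → ℝ,
      HasDerivAt (fun x => Ψ (ζ x)) v x ∧ HasDerivAt L (v 0 / Ψ (ζ x) 0) x ∧
      N x = w x * ((v 0 / Ψ (ζ x) 0 - α * (1 / w x)) ^ 2
        + (contactForm (Ψ (ζ x)) v / Ψ (ζ x) 0) ^ 2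
        + 4 * (v 3 ^ 2 + v 2 ^ 2) / Ψ (ζ x) 0) := by
    filter_upwards [ae_differentiableAt_of_ac hac, ae_mem_Ioo_of_mem_uIcc hab] with x h1 h2 hx
    have hxI := h2 hx
    obtain ⟨h3, h4⟩ := gH_comp h.right (h1 hx) (hpos' x hx)
    have hy0 := h.right.pos _ (hpos' x hx)
    have h5 : HasDerivAt L (fderiv ℝ Ψ (ζ x) (deriv ζ x) 0 / Ψ (ζ x) 0) x :=
      (hasDerivAt_pi.1 h3 0).log hy0.ne'
    refine ⟨hxI, _, h3, h5, ?_⟩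
    rw [hN]
    simp only
    rw [h5.deriv, (hτ x hxI).deriv, ← h4]
    have hw0 := (hwpos x (Ioo_subset_Icc_self hxI)).ne'
    have := hy0.ne'
    unfold gH
    field_simp
    ring
  have hN0 : 0 ≤ᵐ[volume.restrict (Ioc a b)] N := by
    rw [EventuallyLE, ae_restrict_iff' measurableSet_Ioc]
    filter_upwards [hae] with x hx hxm
    have hxu : x ∈ uIcc a b := by rw [uIcc_of_le hab.le]; exact Ioc_subset_Icc_self hxm
    obtain ⟨hxI, v, -, -, hv⟩ := hx hxu
    have := hwpos x (Ioo_subset_Icc_self hxI)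
    have := h.right.pos _ (hpos' x hxu)
    rw [hv, Pi.zero_apply]
    positivity
  refine ⟨?_, fun hle => ?_⟩
  · have : 0 ≤ ∫ x in a..b, N x := by
      rw [intervalIntegral.integral_of_le hab.le]
      exact integral_nonneg_of_ae hN0
    linarith
  have hzero : ∫ x in a..b, N x = 0 := by
    refine le_antisymm (by linarith) ?_
    rw [intervalIntegral.integral_of_le hab.le]
    exact integral_nonneg_of_ae hN0
  have hNz := (intervalIntegral.integral_eq_zero_iff_of_le_of_nonneg_ae hab.le hN0 hNint).1 hzero
  rw [EventuallyEq, ae_restrict_iff' measurableSet_Ioc] at hNz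
  -- In the case of equality each square vanishes almost everywhere; once ψ' = χ' = 0, the contact
  -- form reduces to ω'.
  have hvz : ∀ᵐ x, x ∈ uIcc a b → HasDerivAt (fun x => L x - α * τ x) 0 x ∧
      ∀ k : Fin 4, k ≠ 0 → HasDerivAt (fun x => Ψ (ζ x) k) 0 x := by
    filter_upwards [hae, hNz] with x hx hx0 hxu
    obtain ⟨hxI, v, hv, hLv, hNv⟩ := hx hxu
    have hw0 := hwpos x (Ioo_subset_Icc_self hxI)
    have hy0 := h.right.pos _ (hpos' x hxu)
    rw [hx0 (Ioo_subset_Ioc_self hxI), Pi.zero_apply, eq_comm, mul_eq_zero,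
      or_iff_right hw0.ne'] at hNv
    have e3 : 0 ≤ 4 * (v 3 ^ 2 + v 2 ^ 2) / Ψ (ζ x) 0 := by positivity
    have e1 := sq_nonneg (v 0 / Ψ (ζ x) 0 - α * (1 / w x))
    have e2 := sq_nonneg (contactForm (Ψ (ζ x)) v / Ψ (ζ x) 0)
    have f1 : v 0 / Ψ (ζ x) 0 - α * (1 / w x) = 0 := by
      rw [← sq_eq_zero_iff]; linarith
    have f2 : contactForm (Ψ (ζ x)) v = 0 := by
      have : (contactForm (Ψ (ζ x)) v / Ψ (ζ x) 0) ^ 2 = 0 := by linarith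
      simpa [hy0.ne'] using this
    have f3 : v 3 ^ 2 + v 2 ^ 2 = 0 := by
      have : 4 * (v 3 ^ 2 + v 2 ^ 2) / Ψ (ζ x) 0 = 0 := by linarith
      field_simp at this
      linarith
    have v3 : v 3 = 0 := by nlinarith [sq_nonneg (v 3), sq_nonneg (v 2)]
    have v2 : v 2 = 0 := by nlinarith [sq_nonneg (v 3), sq_nonneg (v 2)]
    have v1 : v 1 = 0 := by
      unfold contactForm at f2
      rw [v2, v3] at f2
      linarith
    refine ⟨?_, fun k hk => ?_⟩
    · rw [← f1]
      exact hLv.fun_sub ((hτ x hxI).const_mul α)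
    · have hvk : v k = 0 := by
        fin_cases k
        exacts [absurd rfl hk, v1, v2, v3]
      rw [← hvk]
      exact hasDerivAt_pi.1 hv k
  have hmem {x : ℝ} (hx : x ∈ Icc a b) : x ∈ uIcc a b := by rwa [uIcc_of_le hab.le]
  -- Derivatives that vanish almost everywhere give constants because the functions are absolutely
  -- continuous; the constants are read off at `a`.
  have hGx : ∀ x ∈ Icc a b, L x = α * τ x + β := by
    obtain ⟨C, hC⟩ := (hL.fun_sub (hτac.const_mul α)).const_of_ae_hasDerivAt_zero
      (by filter_upwards [hvz] with x hx hxu using (hx hxu).1)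
    intro x hx
    have h1 := hC x (hmem hx)
    have h2 := hC a (by simp)
    linarith
  have hkx : ∀ k : Fin 4, k ≠ 0 → ∀ x ∈ Icc a b, Ψ (ζ x) k = 0 := by
    intro k hk
    obtain ⟨C, hC⟩ := (hy k).const_of_ae_hasDerivAt_zero
      (by filter_upwards [hvz] with x hx hxu using (hx hxu).2 k hk)
    intro x hx
    rw [hC x (hmem hx), ← hC a (by simp), ha, vert_apply_of_ne _ hk]
  intro x hx
  rw [← h.right_inv _ (hpos x hx)]
  congr 1
  ext k
  by_cases hk : k = 0
  · subst hk
    simp only [vert, Matrix.cons_val_zero]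
    rw [← hGx x hx, Real.exp_log (h.right.pos _ (hpos x hx))]
  · rw [hkx k hk x hx, vert_apply_of_ne _ hk]

/-! ### The distance -/

theorem curveLength_comp_vert {Φ : (Fin 4 → ℝ) → Fin 4 → ℝ} (h : IsMetricMap Φ) {s₁ s₂ : ℝ}
    (hs : s₁ ≤ s₂) : curveLength (fun u => Φ (vert ((s₂ - s₁) * u + s₁))) = s₂ - s₁ := by
  unfold curveLength
  rw [intervalIntegral.integral_congr (g := fun _ => s₂ - s₁)]
  · simp
  · intro u hu
    rw [uIcc_of_le zero_le_one] at hu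
    -- The larger interval (-1, 2) contains the end points of [0, 1], where the density formula on
    -- an open interval is also needed.
    have := weighted_density_eq h (w := fun _ => 1) (τ := fun x => x)
      (ζ := fun u => Φ (vert ((s₂ - s₁) * u + s₁))) (a := -1) (b := 2) (α := s₂ - s₁) (β := s₁)
      (fun _ _ => one_pos) (fun x _ => by simpa using! hasDerivAt_id x) (fun _ _ => rfl)
      (x := u) ⟨by linarith [hu.1], by linarith [hu.2]⟩
    simp only [one_mul, div_one, mul_one] at this
    simp only
    rw [this, Real.sqrt_sq (by linarith)]

theorem continuousOn_gH {c v : ℝ → Fin 4 → ℝ} {S : Set ℝ} (hc : ContinuousOn c S)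
    (hv : ContinuousOn v S) (hpos : ∀ s ∈ S, 0 < c s 0) :
    ContinuousOn (fun s => gH (c s) (v s) (v s)) S := by
  have hc' (k : Fin 4) : ContinuousOn (fun s => c s k) S := continuousOn_pi.1 hc k
  have hv' (k : Fin 4) : ContinuousOn (fun s => v s k) S := continuousOn_pi.1 hv k
  have hne : ∀ s ∈ S, c s 0 ≠ 0 := fun s hs => (hpos s hs).ne'
  have hne2 : ∀ s ∈ S, c s 0 ^ 2 ≠ 0 := fun s hs => pow_ne_zero 2 (hne s hs)
  unfold gH contactForm
  fun_prop (disch := assumption)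

/-- Along the curve the calibrating function log Ψ₀ grows no faster than arc length; integrate. -/
theorem sub_le_curveLength {Ψ : (Fin 4 → ℝ) → Fin 4 → ℝ} (h : IsMetricMap Ψ)
    {c : ℝ → Fin 4 → ℝ} (hc : ContDiffOn ℝ 1 c (Icc 0 1)) (hpos : ∀ s ∈ Icc (0 : ℝ) 1, 0 < c s 0) :
    Real.log (Ψ (c 1) 0) - Real.log (Ψ (c 0) 0) ≤ curveLength c := by
  have huIcc : uIcc (0 : ℝ) 1 = Icc 0 1 := uIcc_of_le zero_le_one
  have hL : AbsolutelyContinuousOnInterval (fun t => Real.log (Ψ (c t) 0)) 0 1 :=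
    absolutelyContinuousOnInterval_comp (F := fun x => Real.log (Ψ x 0))
      (fun x hx => (contDiffAt_log_apply h hx).of_le (by simp))
      (fun k => ContDiffOn.absolutelyContinuousOnInterval
        (by rw [huIcc]; exact contDiffOn_pi.1 hc k)) (by rwa [huIcc])
  rw [← hL.integral_deriv_eq_sub]
  -- The curve is C¹ only within [0, 1], so integrability of the speed is obtained from the
  -- one-sided derivative, which agrees with `deriv` away from the two end points.
  have hcont : ContinuousOn (fun s => √(gH (c s) (derivWithin c (Icc 0 1) s)
      (derivWithin c (Icc 0 1) s))) (Icc 0 1) :=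
    (continuousOn_gH hc.continuousOn
      (hc.continuousOn_derivWithin (uniqueDiffOn_Icc one_pos) le_rfl) hpos).sqrt
  have heq : ∀ᵐ s, s ∈ uIoc (0 : ℝ) 1 → √(gH (c s) (derivWithin c (Icc 0 1) s)
      (derivWithin c (Icc 0 1) s)) = √(gH (c s) (deriv c s) (deriv c s)) := by
    filter_upwards [ae_mem_Ioo_of_mem_uIcc one_pos] with s hs hsm
    have hsI := hs (uIoc_subset_uIcc hsm)
    rw [derivWithin_of_mem_nhds (Icc_mem_nhds hsI.1 hsI.2)]
  have hint : IntervalIntegrable (fun s => √(gH (c s) (deriv c s) (deriv c s))) volume 0 1 :=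
    (ContinuousOn.intervalIntegrable (by rwa [huIcc])).congr_ae
      ((ae_restrict_iff' measurableSet_uIoc).2 heq)
  refine intervalIntegral.integral_mono_on_of_le_Ioo zero_le_one hL.intervalIntegrable_deriv hint
    fun s hs => ?_
  have hsI := Ioo_subset_Icc_self hs
  have hd : DifferentiableAt ℝ c s :=
    ((hc.differentiableOn one_ne_zero) s hsI).differentiableAt (Icc_mem_nhds hs.1 hs.2)
  obtain ⟨h3, h4⟩ := gH_comp h hd (hpos s hsI)
  have hy0 := h.pos _ (hpos s hsI)
  rw [((hasDerivAt_pi.1 h3 0).log hy0.ne').deriv, ← h4]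
  exact Real.le_sqrt_of_sq_le (sq_le_gH hy0 _)

/-- The geodesic segment attains this length, and the calibration excludes anything shorter. -/
theorem IsIsometryPair.hdist_eq {Φ Ψ : (Fin 4 → ℝ) → Fin 4 → ℝ} (h : IsIsometryPair Φ Ψ)
    {s₁ s₂ : ℝ} (hs : s₁ ≤ s₂) : hdist (Φ (vert s₁)) (Φ (vert s₂)) = s₂ - s₁ := by
  refine IsLeast.csInf_eq ⟨?_, ?_⟩
  · refine ⟨fun u => Φ (vert ((s₂ - s₁) * u + s₁)), ?_, fun u _ => h.left.pos _ (vert_pos _),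
      by simp, by simp, (curveLength_comp_vert h.left hs).symm⟩
    exact (((contDiff_comp_vert h.left).of_le (by simp)).comp
      (f := fun u : ℝ => (s₂ - s₁) * u + s₁) (by fun_prop)).contDiffOn
  · rintro _ ⟨c, hc, hpos, h0, h1, rfl⟩
    have := sub_le_curveLength h.right hc hpos
    rw [h0, h1, h.left_inv _ (vert_pos _), h.left_inv _ (vert_pos _)] at this
    simpa [vert] using this

theorem IsIsometryPair.isAffineMinimizingGeodesic {Φ Ψ : (Fin 4 → ℝ) → Fin 4 → ℝ}
    (h : IsIsometryPair Φ Ψ) {γ : ℝ → Fin 4 → ℝ} {t₁ t₂ α β : ℝ} (hα : 0 ≤ α) (ht : t₁ ≤ t₂)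
    (hγ : ∀ t ∈ Icc t₁ t₂, γ t = Φ (vert (α * t + β))) :
    IsAffineMinimizingGeodesic γ t₁ t₂ α := by
  refine ⟨hα, ⟨_, β, h.isUnitSpeedGeodesic, hγ⟩, ?_⟩
  rw [hγ _ (left_mem_Icc.2 ht), hγ _ (right_mem_Icc.2 ht), h.hdist_eq (by gcongr)]
  ring

/-! ### Minimizers of the energy -/

/-- The weighted bound with w = 1 and τ(t) = t; any other minimizer falls under its case of
equality. -/
theorem IsIsometryPair.isEnergyMinimizer {Φ Ψ : (Fin 4 → ℝ) → Fin 4 → ℝ}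
    (h : IsIsometryPair Φ Ψ) {γ : ℝ → Fin 4 → ℝ} {t₁ t₂ α β : ℝ} (ht : t₁ < t₂)
    (hγ : ∀ t ∈ Icc t₁ t₂, γ t = Φ (vert (α * t + β))) :
    IsEnergyMinimizer t₁ t₂ (γ t₁) (γ t₂) γ ∧
      ∀ ζ, IsEnergyMinimizer t₁ t₂ (γ t₁) (γ t₂) ζ → EqOn ζ γ (Icc t₁ t₂) := by
  have huIcc : uIcc t₁ t₂ = Icc t₁ t₂ := uIcc_of_le ht.le
  have h1 := hγ _ (left_mem_Icc.2 ht.le)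
  have h2 := hγ _ (right_mem_Icc.2 ht.le)
  have hτ : ∀ x ∈ Ioo t₁ t₂, HasDerivAt (fun x : ℝ => x) (1 / (fun _ => 1 : ℝ → ℝ) x) x :=
    fun x _ => by simpa using! hasDerivAt_id x
  obtain ⟨hint, hen⟩ := weighted_energy_eq h.left (w := fun _ => 1) (τ := fun x => x) ht
    continuousOn_const (fun _ _ => one_pos) continuousOn_id hτ
    (fun t hx => hγ t (Ioo_subset_Icc_self hx))
  simp only [one_mul] at hint hen
  have hadm : EnergyAdmissible t₁ t₂ (γ t₁) (γ t₂) γ := by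
    refine ⟨fun k => ContDiffOn.absolutelyContinuousOnInterval ?_,
      fun t htm => ?_, hint, rfl, rfl⟩
    · rw [huIcc]
      have hg : ContDiff ℝ 1 (fun t => Φ (vert (α * t + β))) :=
        ((contDiff_comp_vert h.left).of_le (by simp)).comp
          (f := fun t : ℝ => α * t + β) (by fun_prop)
      exact (contDiff_pi.1 hg k).contDiffOn.congr fun t htm => by rw [hγ t htm]
    · rw [hγ t htm]
      exact h.left.pos _ (vert_pos _)
  have key (ζ : ℝ → Fin 4 → ℝ) (hζ : EnergyAdmissible t₁ t₂ (γ t₁) (γ t₂) ζ) :=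
    weighted_energy_lower_bound h (w := fun _ => 1) (τ := fun x => x) (ζ := ζ) (α := α) (β := β)
      ht (fun _ _ => one_pos) contDiffOn_id hτ hζ.ac hζ.pos (by simpa using! hζ.finite)
      (by rw [hζ.left, h1, h.left_inv _ (vert_pos _)])
      (by rw [hζ.right, h2, h.left_inv _ (vert_pos _)])
  simp only [one_mul] at key
  have hle (ζ : ℝ → Fin 4 → ℝ) (hζ : EnergyAdmissible t₁ t₂ (γ t₁) (γ t₂) ζ) :
      energy t₁ t₂ γ ≤ energy t₁ t₂ ζ := hen.trans_le (key ζ hζ).1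
  refine ⟨⟨hadm, hle⟩, fun ζ hζ t htm => ?_⟩
  rw [hγ t htm]
  exact (key ζ hζ.1).2 ((hζ.2 γ hadm).trans hen.le) t htm

/-! ### Minimizers of the functional `𝓜` -/

/-- The curve `(η, ω, ψ, χ)` of the potentials `D`, as a function of `θ`. -/
noncomputable def potentialCurve (D : ℝ → Fin 4 → ℝ) (θ : ℝ) : Fin 4 → ℝ :=
  ![etaOf D θ, D θ 1, D θ 2, D θ 3]

theorem curveOf_eq (D : ℝ → Fin 4 → ℝ) (t : ℝ) : curveOf D t = potentialCurve D (thetaOf t) :=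
  rfl

theorem tan_half_pos {θ : ℝ} (h0 : 0 < θ) (hπ : θ < π) : 0 < Real.tan (θ / 2) :=
  Real.tan_pos_of_pos_of_lt_pi_div_two (by linarith) (by linarith)

theorem thetaOf_tOf {θ : ℝ} (h0 : 0 < θ) (hπ : θ < π) : thetaOf (tOf θ) = θ := by
  rw [thetaOf, tOf, Real.exp_log (tan_half_pos h0 hπ),
    Real.arctan_tan (by linarith) (by linarith)]
  ring

theorem tOf_thetaOf (t : ℝ) : tOf (thetaOf t) = t := by
  rw [thetaOf, tOf, mul_div_cancel_left₀ _ two_ne_zero, Real.tan_arctan, Real.log_exp]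

theorem hasDerivAt_tOf {θ : ℝ} (h0 : 0 < θ) (hπ : θ < π) :
    HasDerivAt tOf (1 / Real.sin θ) θ := by
  have hc : 0 < Real.cos (θ / 2) := Real.cos_pos_of_mem_Ioo ⟨by linarith, by linarith⟩
  have hs : 0 < Real.sin (θ / 2) := Real.sin_pos_of_pos_of_lt_pi (by linarith) (by linarith)
  have h1 : HasDerivAt (fun θ : ℝ => θ / 2) (1 / 2) θ := (hasDerivAt_id θ).div_const 2
  have h1' := (Real.hasDerivAt_tan hc.ne').comp θ h1
  have h2 : HasDerivAt tOf _ θ := h1'.log (tan_half_pos h0 hπ).ne'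
  convert h2 using 1
  have h3 : Real.sin θ = 2 * Real.sin (θ / 2) * Real.cos (θ / 2) := by
    rw [← Real.sin_two_mul]; ring_nf
  rw [h3, Function.comp_apply, Real.tan_eq_sin_div_cos]
  field_simp

theorem contDiffAt_tOf {θ : ℝ} (h0 : 0 < θ) (hπ : θ < π) : ContDiffAt ℝ ∞ tOf θ := by
  have hc : 0 < Real.cos (θ / 2) := Real.cos_pos_of_mem_Ioo ⟨by linarith, by linarith⟩
  exact ((Real.contDiffAt_tan.2 hc.ne').comp θ (f := fun θ : ℝ => θ / 2) (by fun_prop)).log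
    (tan_half_pos h0 hπ).ne'

theorem tOf_lt_tOf {θ₁ θ₂ : ℝ} (h1 : 0 < θ₁) (h12 : θ₁ < θ₂) (h2 : θ₂ < π) :
    tOf θ₁ < tOf θ₂ :=
  Real.log_lt_log (tan_half_pos h1 (h12.trans h2))
    (Real.tan_lt_tan_of_lt_of_lt_pi_div_two (by linarith) (by linarith) (by linarith))

theorem thetaOf_mem_Icc {θ₁ θ₂ t : ℝ} (h1 : 0 < θ₁) (h12 : θ₁ < θ₂) (h2 : θ₂ < π)
    (ht : t ∈ Icc (tOf θ₁) (tOf θ₂)) : thetaOf t ∈ Icc θ₁ θ₂ := by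
  have hmono {s t : ℝ} (h : s ≤ t) : thetaOf s ≤ thetaOf t := by
    unfold thetaOf
    have := Real.arctan_strictMono.monotone (Real.exp_le_exp.2 h)
    linarith
  have e1 := hmono ht.1
  have e2 := hmono ht.2
  rw [thetaOf_tOf h1 (h12.trans h2)] at e1
  rw [thetaOf_tOf (h1.trans h12) h2] at e2
  exact ⟨e1, e2⟩

/-- Since η = e^σ sin² θ, η'/η = σ' + 2 cot θ. Expanding sin θ (η'/η)² produces the cross term 4σ'
cos θ, which is (4σ cos θ)' + 4σ sin θ; this accounts for the term 4σ in 𝓜. -/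
theorem massDensity_eq {D : ℝ → Fin 4 → ℝ} {θ : ℝ} (h0 : 0 < θ) (hπ : θ < π)
    (hD : DifferentiableAt ℝ D θ) :
    massDensity D θ = Real.sin θ * gH (potentialCurve D θ) (deriv (potentialCurve D) θ)
      (deriv (potentialCurve D) θ) - deriv (fun y => 4 * Real.cos y * D y 0) θ
      - 4 * Real.cos θ ^ 2 / Real.sin θ := by
  have hs : Real.sin θ ≠ 0 := (Real.sin_pos_of_pos_of_lt_pi h0 hπ).ne'
  have hk (k : Fin 4) : HasDerivAt (fun y => D y k) (deriv D θ k) θ :=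
    hasDerivAt_pi.1 hD.hasDerivAt k
  have hη : HasDerivAt (etaOf D) (Real.exp (D θ 0) * deriv D θ 0 * Real.sin θ ^ 2
      + Real.exp (D θ 0) * (2 * Real.sin θ * Real.cos θ)) θ := by
    simpa using! (hk 0).exp.fun_mul ((Real.hasDerivAt_sin θ).fun_pow 2)
  have hP : HasDerivAt (potentialCurve D) ![Real.exp (D θ 0) * deriv D θ 0 * Real.sin θ ^ 2
      + Real.exp (D θ 0) * (2 * Real.sin θ * Real.cos θ), deriv D θ 1, deriv D θ 2, deriv D θ 3]
      θ := by
    refine hasDerivAt_pi.2 fun k => ?_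
    fin_cases k
    exacts [hη, hk 1, hk 2, hk 3]
  have hc : HasDerivAt (fun y => 4 * Real.cos y * D y 0)
      (4 * -Real.sin θ * D θ 0 + 4 * Real.cos θ * deriv D θ 0) θ :=
    ((Real.hasDerivAt_cos θ).const_mul 4).fun_mul (hk 0)
  rw [hP.deriv, hc.deriv]
  simp only [massDensity, gH, contactForm, potentialCurve, etaOf, Matrix.cons_val]
  have he := (Real.exp_pos (D θ 0)).ne'
  field_simp
  ring

/-- Of the two extra terms in `massDensity_eq`, one integrates to a boundary term and the other does
not involve the potentials, so 𝓜 and the weighted energy have the same minimizers for given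
Dirichlet data. -/
theorem mass_eq_weighted_energy {D : ℝ → Fin 4 → ℝ} {θ₁ θ₂ : ℝ} (h1 : 0 < θ₁) (h12 : θ₁ < θ₂)
    (h2 : θ₂ < π) (hac : ∀ k, AbsolutelyContinuousOnInterval (fun θ => D θ k) θ₁ θ₂) :
    (IntervalIntegrable (massDensity D) volume θ₁ θ₂ ↔
      IntervalIntegrable (fun θ => Real.sin θ * gH (potentialCurve D θ)
        (deriv (potentialCurve D) θ) (deriv (potentialCurve D) θ)) volume θ₁ θ₂) ∧
    (IntervalIntegrable (massDensity D) volume θ₁ θ₂ →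
      mass θ₁ θ₂ D = (∫ θ in θ₁..θ₂, Real.sin θ * gH (potentialCurve D θ)
        (deriv (potentialCurve D) θ) (deriv (potentialCurve D) θ))
        - (4 * Real.cos θ₂ * D θ₂ 0 - 4 * Real.cos θ₁ * D θ₁ 0)
        - ∫ θ in θ₁..θ₂, 4 * Real.cos θ ^ 2 / Real.sin θ) := by
  have hB : AbsolutelyContinuousOnInterval (fun y => 4 * Real.cos y * D y 0) θ₁ θ₂ := by
    refine AbsolutelyContinuousOnInterval.fun_mul (f := fun y => 4 * Real.cos y) ?_ (hac 0)
    exact ContDiffOn.absolutelyContinuousOnInterval (by fun_prop)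
  have hC : IntervalIntegrable (fun θ => 4 * Real.cos θ ^ 2 / Real.sin θ) volume θ₁ θ₂ := by
    refine ContinuousOn.intervalIntegrable ?_
    rw [uIcc_of_le h12.le]
    refine ContinuousOn.div (by fun_prop) (by fun_prop) fun x hx => ?_
    exact (Real.sin_pos_of_pos_of_lt_pi (h1.trans_le hx.1) (hx.2.trans_lt h2)).ne'
  have hae : ∀ᵐ θ, θ ∈ uIoc θ₁ θ₂ → massDensity D θ = Real.sin θ * gH (potentialCurve D θ)
      (deriv (potentialCurve D) θ) (deriv (potentialCurve D) θ)
      - deriv (fun y => 4 * Real.cos y * D y 0) θ - 4 * Real.cos θ ^ 2 / Real.sin θ := by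
    filter_upwards [ae_differentiableAt_of_ac hac, ae_mem_Ioo_of_mem_uIcc h12] with x e1 e2 hx
    have hxu := uIoc_subset_uIcc hx
    have hxI := e2 hxu
    exact massDensity_eq (h1.trans hxI.1) (hxI.2.trans h2) (e1 hxu)
  have hae' := (ae_restrict_iff' measurableSet_uIoc).2 hae
  have hiff : IntervalIntegrable (massDensity D) volume θ₁ θ₂ ↔
      IntervalIntegrable (fun θ => Real.sin θ * gH (potentialCurve D θ)
        (deriv (potentialCurve D) θ) (deriv (potentialCurve D) θ)) volume θ₁ θ₂ := by
    refine ⟨fun h => ?_, fun h => ?_⟩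
    · have := ((h.congr_ae hae').add hB.intervalIntegrable_deriv).add hC
      refine this.congr_ae (Eventually.of_forall fun x => ?_)
      simp only
      ring
    · exact ((h.sub hB.intervalIntegrable_deriv).sub hC).congr_ae (EventuallyEq.symm hae')
  refine ⟨hiff, fun h => ?_⟩
  have hw := hiff.1 h
  rw [mass, intervalIntegral.integral_congr_ae hae,
    intervalIntegral.integral_sub (hw.sub hB.intervalIntegrable_deriv) hC,
    intervalIntegral.integral_sub hw hB.intervalIntegrable_deriv, hB.integral_deriv_eq_sub]

/-- The weighted bound with w = sin θ and τ = ln tan(θ/2), for which τ' = 1 / sin θ. -/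
theorem IsIsometryPair.isMassMinimizer {Φ Ψ : (Fin 4 → ℝ) → Fin 4 → ℝ}
    (h : IsIsometryPair Φ Ψ) {D : ℝ → Fin 4 → ℝ} {θ₁ θ₂ α β : ℝ} (h1 : 0 < θ₁) (h12 : θ₁ < θ₂)
    (h2 : θ₂ < π)
    (hD : ∀ θ ∈ Icc θ₁ θ₂, potentialCurve D θ = Φ (vert (α * tOf θ + β))) :
    IsMassMinimizer θ₁ θ₂ (D θ₁) (D θ₂) D ∧
      (∀ E, IsMassMinimizer θ₁ θ₂ (D θ₁) (D θ₂) E → EqOn E D (Icc θ₁ θ₂)) ∧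
      ContDiffOn ℝ ∞ D (Icc θ₁ θ₂) := by
  have huIcc : uIcc θ₁ θ₂ = Icc θ₁ θ₂ := uIcc_of_le h12.le
  have hsin : ∀ x ∈ Icc θ₁ θ₂, 0 < Real.sin x := fun x hx =>
    Real.sin_pos_of_pos_of_lt_pi (h1.trans_le hx.1) (hx.2.trans_lt h2)
  have hτ : ∀ x ∈ Ioo θ₁ θ₂, HasDerivAt tOf (1 / Real.sin x) x := fun x hx =>
    hasDerivAt_tOf (h1.trans hx.1) (hx.2.trans h2)
  have hτs : ContDiffOn ℝ ∞ tOf (Icc θ₁ θ₂) := fun x hx =>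
    (contDiffAt_tOf (h1.trans_le hx.1) (hx.2.trans_lt h2)).contDiffWithinAt
  have hg : ContDiffOn ℝ ∞ (potentialCurve D) (Icc θ₁ θ₂) :=
    ((contDiff_comp_vert h.left).comp_contDiffOn
      (f := fun θ => α * tOf θ + β) (by fun_prop)).congr hD
  have hη (E : ℝ → Fin 4 → ℝ) : ∀ θ ∈ Icc θ₁ θ₂,
      E θ 0 = Real.log (potentialCurve E θ 0) - 2 * Real.log (Real.sin θ) := by
    intro θ hθ
    have := hsin θ hθ
    simp only [potentialCurve, Matrix.cons_val_zero, etaOf]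
    rw [Real.log_mul (Real.exp_ne_zero _) (by positivity), Real.log_exp, Real.log_pow]
    push_cast; ring
  have hsmooth : ContDiffOn ℝ ∞ D (Icc θ₁ θ₂) := by
    refine contDiffOn_pi.2 fun k => ?_
    have hgk := contDiffOn_pi.1 hg
    fin_cases k
    · refine ContDiffOn.congr (ContDiffOn.sub ((hgk 0).log fun θ hθ => ?_)
        (contDiffOn_const.mul (Real.contDiff_sin.contDiffOn.log fun θ hθ => ?_))) (hη D)
      · rw [hD θ hθ]
        exact (h.left.pos _ (vert_pos _)).ne'
      · exact (hsin θ hθ).ne'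
    exacts [hgk 1, hgk 2, hgk 3]
  have hDac : ∀ k, AbsolutelyContinuousOnInterval (fun θ => D θ k) θ₁ θ₂ := fun k => by
    refine ContDiffOn.absolutelyContinuousOnInterval ?_
    rw [huIcc]
    exact (contDiffOn_pi.1 hsmooth k).of_le (by simp)
  obtain ⟨hint, hen⟩ := weighted_energy_eq h.left (w := Real.sin) (τ := tOf) h12
    Real.continuous_sin.continuousOn hsin hτs.continuousOn hτ
    (fun t hx => hD t (Ioo_subset_Icc_self hx))
  obtain ⟨hDi, hDm⟩ := mass_eq_weighted_energy h1 h12 h2 hDac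
  have hadm : MassAdmissible θ₁ θ₂ (D θ₁) (D θ₂) D := ⟨hDac, hDi.2 hint, rfl, rfl⟩
  have hpc (E : ℝ → Fin 4 → ℝ) {θ : ℝ} (hθ : θ ∈ Icc θ₁ θ₂) : 0 < potentialCurve E θ 0 := by
    have := hsin θ hθ
    simp only [potentialCurve, Matrix.cons_val_zero, etaOf]
    positivity
  have hpeq {E E' : ℝ → Fin 4 → ℝ} {θ : ℝ} (he : E θ = E' θ) :
      potentialCurve E θ = potentialCurve E' θ := by
    simp [potentialCurve, etaOf, he]
  have key (E : ℝ → Fin 4 → ℝ) (hE : MassAdmissible θ₁ θ₂ (D θ₁) (D θ₂) E) :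
      mass θ₁ θ₂ D ≤ mass θ₁ θ₂ E ∧
        (mass θ₁ θ₂ E ≤ mass θ₁ θ₂ D → EqOn E D (Icc θ₁ θ₂)) := by
    obtain ⟨hEi, hEm⟩ := mass_eq_weighted_energy h1 h12 h2 hE.ac
    have hac' : ∀ k, AbsolutelyContinuousOnInterval (fun θ => potentialCurve E θ k) θ₁ θ₂ := by
      -- σ is bounded on the interval and exp is Lipschitz on bounded sets.
      have hexp : AbsolutelyContinuousOnInterval (fun θ => Real.exp (E θ 0)) θ₁ θ₂ := by
        obtain ⟨M, hM⟩ := (hE.ac 0).exists_bound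
        obtain ⟨K, hK⟩ := (Real.contDiff_exp (n := 1)).contDiffOn.exists_lipschitzOnWith
          (by decide) (convex_closedBall (0 : ℝ) M) (isCompact_closedBall 0 M)
        exact hK.comp_absolutelyContinuousOnInterval (hE.ac 0) fun t ht => by
          simpa using hM t ht
      intro k
      fin_cases k
      · exact hexp.fun_mul (ContDiffOn.absolutelyContinuousOnInterval
          (f := fun θ => Real.sin θ ^ 2) (by fun_prop))
      exacts [hE.ac 1, hE.ac 2, hE.ac 3]
    obtain ⟨hlow, heq⟩ := weighted_energy_lower_bound h (w := Real.sin) (τ := tOf)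
      (ζ := potentialCurve E) (α := α) (β := β) h12 hsin (hτs.of_le (by simp)) hτ hac'
      (fun t ht => hpc E ht) (hEi.1 hE.finite)
      (by rw [hpeq hE.left, hD _ (left_mem_Icc.2 h12.le), h.left_inv _ (vert_pos _)])
      (by rw [hpeq hE.right, hD _ (right_mem_Icc.2 h12.le), h.left_inv _ (vert_pos _)])
    -- The boundary terms of `E` and `D` coincide, so comparing masses is comparing weighted
    -- energies.
    rw [hDm hadm.finite, hEm hE.finite, hE.left, hE.right, hen]
    refine ⟨by linarith, fun hle θ hθ => ?_⟩
    have hpot : potentialCurve E θ = potentialCurve D θ := by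
      rw [hD θ hθ]
      exact heq (by linarith) θ hθ
    ext k
    fin_cases k
    · rw [Fin.zero_eta, hη E θ hθ, hη D θ hθ, hpot]
    exacts [congrFun hpot 1, congrFun hpot 2, congrFun hpot 3]
  exact ⟨⟨hadm, fun E hE => (key E hE).1⟩,
    fun E hE => (key E hE.1).2 (hE.2 D hadm), hsmooth⟩

/-- The potentials of a curve in `{η > 0}` parametrized by `θ`. -/
noncomputable def potentialsOf (g : ℝ → Fin 4 → ℝ) (θ : ℝ) : Fin 4 → ℝ :=
  ![Real.log (g θ 0) - 2 * Real.log (Real.sin θ), g θ 1, g θ 2, g θ 3]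

theorem potentialCurve_potentialsOf {g : ℝ → Fin 4 → ℝ} {θ : ℝ} (h0 : 0 < θ) (hπ : θ < π)
    (hg : 0 < g θ 0) : potentialCurve (potentialsOf g) θ = g θ := by
  have hs := Real.sin_pos_of_pos_of_lt_pi h0 hπ
  have he : etaOf (potentialsOf g) θ = g θ 0 := by
    simp only [etaOf, potentialsOf, Matrix.cons_val_zero]
    rw [Real.exp_sub, Real.exp_log hg, two_mul, Real.exp_add, Real.exp_log hs]
    field_simp
  ext k
  fin_cases k
  exacts [he, rfl, rfl, rfl]

theorem eq_of_potentialCurve_eq {D E : ℝ → Fin 4 → ℝ} {θ : ℝ} (h0 : 0 < θ) (hπ : θ < π)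
    (h : potentialCurve D θ = potentialCurve E θ) : D θ = E θ := by
  have hs := (Real.sin_pos_of_pos_of_lt_pi h0 hπ).ne'
  have h0' := congrFun h 0
  simp only [potentialCurve, Matrix.cons_val_zero, etaOf, mul_eq_mul_right_iff,
    pow_eq_zero_iff two_ne_zero, hs, or_false, Real.exp_eq_exp] at h0'
  ext k
  fin_cases k
  exacts [h0', congrFun h 1, congrFun h 2, congrFun h 3]

/-- Existence, uniqueness and smoothness of the minimizer of `𝓜` for Dirichlet data. -/
theorem exists_isMassMinimizer {θ₁ θ₂ : ℝ} (p q : Fin 4 → ℝ) (h1 : 0 < θ₁) (h12 : θ₁ < θ₂)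
    (h2 : θ₂ < π) : ∃ D : ℝ → Fin 4 → ℝ,
      IsMassMinimizer θ₁ θ₂ p q D ∧
      (∀ E, IsMassMinimizer θ₁ θ₂ p q E → EqOn E D (Icc θ₁ θ₂)) ∧
      ContDiffOn ℝ ∞ D (Icc θ₁ θ₂) ∧
      ∃ α : ℝ, IsAffineMinimizingGeodesic (curveOf D) (tOf θ₁) (tOf θ₂) α := by
  set P := potentialCurve (fun _ => p) θ₁ with hP
  set Q := potentialCurve (fun _ => q) θ₂ with hQ
  have hs1 := Real.sin_pos_of_pos_of_lt_pi h1 (h12.trans h2)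
  have hs2 := Real.sin_pos_of_pos_of_lt_pi (h1.trans h12) h2
  have hP0 : 0 < P 0 := by simp only [hP, potentialCurve, etaOf, Matrix.cons_val_zero]; positivity
  have hQ0 : 0 < Q 0 := by simp only [hQ, potentialCurve, etaOf, Matrix.cons_val_zero]; positivity
  obtain ⟨Φ, Ψ, h, s₁, s₂, hs, e1, e2⟩ := exists_isometryPair hP0 hQ0
  have ht := tOf_lt_tOf h1 h12 h2
  -- The affine map t ↦ αt + β takes the two values of t to the positions s₁ ≤ s₂ on the vertical
  -- line; α = 0 when the two points coincide.
  set α := (s₂ - s₁) / (tOf θ₂ - tOf θ₁) with hα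
  set β := s₁ - α * tOf θ₁ with hβ
  have hα0 : 0 ≤ α := div_nonneg (by linarith) (by linarith)
  have hb1 : α * tOf θ₁ + β = s₁ := by rw [hβ]; ring
  have hb2 : α * tOf θ₂ + β = s₂ := by
    have : tOf θ₂ - tOf θ₁ ≠ 0 := by linarith
    rw [hβ, hα]; field_simp; ring
  set D := potentialsOf (fun θ => Φ (vert (α * tOf θ + β))) with hDdef
  have hD : ∀ θ ∈ Icc θ₁ θ₂, potentialCurve D θ = Φ (vert (α * tOf θ + β)) := fun θ hθ =>
    potentialCurve_potentialsOf (h1.trans_le hθ.1) (hθ.2.trans_lt h2)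
      (h.left.pos _ (vert_pos _))
  have hD1 : D θ₁ = p := by
    refine eq_of_potentialCurve_eq (E := fun _ => p) h1 (h12.trans h2) ?_
    rw [hD _ (left_mem_Icc.2 h12.le), hb1, ← e1, h.right_inv _ hP0]
  have hD2 : D θ₂ = q := by
    refine eq_of_potentialCurve_eq (E := fun _ => q) (h1.trans h12) h2 ?_
    rw [hD _ (right_mem_Icc.2 h12.le), hb2, ← e2, h.right_inv _ hQ0]
  obtain ⟨m1, m2, m3⟩ := h.isMassMinimizer h1 h12 h2 hD
  rw [hD1, hD2] at m1 m2
  refine ⟨D, m1, m2, m3, α, h.isAffineMinimizingGeodesic (β := β) hα0 ht.le fun t htm => ?_⟩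
  rw [curveOf_eq, hD _ (thetaOf_mem_Icc h1 h12 h2 htm), tOf_thetaOf]

namespace Consts

/-! ### The explicit curves are geodesics -/

/-- `√(4 c₁² + c₅⁴)`. -/
noncomputable def rad (c : Consts) : ℝ := √(4 * c.c₁ ^ 2 + c.c₅ ^ 4)

/-- The denominator `c₅² + √(4 c₁² + c₅⁴) cosh (α t) = 2 / η`. -/
noncomputable def den (c : Consts) (t : ℝ) : ℝ := c.c₅ ^ 2 + c.rad * Real.cosh (c.α * t)

theorem rad_sq (c : Consts) : c.rad ^ 2 = 4 * c.c₁ ^ 2 + c.c₅ ^ 4 :=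
  Real.sq_sqrt (by positivity)

theorem Valid.rad_pos {c : Consts} (hc : c.Valid) : 0 < c.rad := by
  have := hc.1
  exact Real.sqrt_pos.2 (by positivity)

theorem Valid.den_pos {c : Consts} (hc : c.Valid) (t : ℝ) : 0 < c.den t := by
  have := hc.rad_pos
  have := Real.cosh_pos (c.α * t)
  unfold den
  positivity

theorem den_neg (c : Consts) (t : ℝ) : c.den (-t) = c.den t := by
  simp [den]

theorem Valid.c₄_eq {c : Consts} (hc : c.Valid) : c.c₄ = c.c₅ / (2 * c.c₁) := by
  have := hc.1
  rw [hc.2.1]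
  field_simp

theorem eta_eq (c : Consts) (t : ℝ) : c.eta t = 2 / c.den t := by
  have h : 1 / 2 * c.c₅ ^ 2 + 1 / 2 * √(4 * c.c₁ ^ 2 + c.c₅ ^ 4) * Real.cosh (c.α * t)
      = c.den t / 2 := by
    rw [den, rad]; ring
  rw [eta, h, inv_div]

theorem cos_neg_two_mul_arctan (y : ℝ) :
    Real.cos (-2 * Real.arctan y) = (1 - y ^ 2) / (1 + y ^ 2) := by
  have : 1 + y ^ 2 ≠ 0 := by positivity
  rw [neg_mul, Real.cos_neg, Real.cos_two_mul, Real.cos_sq_arctan]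
  field_simp
  ring

theorem sin_neg_two_mul_arctan (y : ℝ) :
    Real.sin (-2 * Real.arctan y) = -(2 * y) / (1 + y ^ 2) := by
  have h0 : 1 + y ^ 2 ≠ 0 := by positivity
  rw [neg_mul, Real.sin_neg, Real.sin_two_mul, mul_assoc, Real.sin_arctan, Real.cos_arctan,
    div_mul_div_comm, mul_one, Real.mul_self_sqrt (by positivity)]
  field_simp

/-- With R = √(4c₁² + c₅⁴) one has (2c₁)² = (R - c₅²)(R + c₅²). Hence the square of the argument of
arctan is (R - c₅²)/(R + c₅²) · tanh²(αt/2), and the half-angle formulas give fractions with the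
same denominator as η. -/
theorem Valid.cos_sin_f {c : Consts} (hc : c.Valid) (t : ℝ) :
    Real.cos (c.f t) = (c.rad + c.c₅ ^ 2 * Real.cosh (c.α * t)) / c.den t ∧
      Real.sin (c.f t) = -(2 * c.c₁ * Real.sinh (c.α * t)) / c.den t := by
  have h1 := hc.1
  have hR := hc.rad_pos
  have hR2 := c.rad_sq
  have hd := hc.den_pos t
  have hf : c.f t = -2 * Real.arctan ((c.rad - c.c₅ ^ 2) / (2 * c.c₁)
    * Real.tanh (c.α * t / 2)) := rfl
  have hC : Real.cosh (c.α * t) = Real.cosh (c.α * t / 2) ^ 2 + Real.sinh (c.α * t / 2) ^ 2 := by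
    rw [← Real.cosh_two_mul]; ring_nf
  have hS : Real.sinh (c.α * t) = 2 * Real.sinh (c.α * t / 2) * Real.cosh (c.α * t / 2) := by
    rw [← Real.sinh_two_mul]; ring_nf
  have hcs := Real.cosh_sq (c.α * t / 2)
  have hch := Real.cosh_pos (c.α * t / 2)
  rw [hf, cos_neg_two_mul_arctan, sin_neg_two_mul_arctan, Real.tanh_eq_sinh_div_cosh]
  rw [den, hC] at hd ⊢
  rw [hS]
  set C := Real.cosh (c.α * t / 2)
  set S := Real.sinh (c.α * t / 2)
  set R := c.rad
  have hpq : (2 * c.c₁) ^ 2 = (R - c.c₅ ^ 2) * (R + c.c₅ ^ 2) := by linear_combination -hR2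
  have hp : 0 < R + c.c₅ ^ 2 := by positivity
  have hq : 0 < R - c.c₅ ^ 2 := by
    have : 0 < (R - c.c₅ ^ 2) * (R + c.c₅ ^ 2) := by rw [← hpq]; positivity
    exact pos_of_mul_pos_left this hp.le
  have hk : ((R - c.c₅ ^ 2) / (2 * c.c₁) * (S / C)) ^ 2
      = (R - c.c₅ ^ 2) * S ^ 2 / ((R + c.c₅ ^ 2) * C ^ 2) := by
    rw [mul_pow, div_pow, div_pow, hpq]
    field_simp
  have hadd : 1 + (R - c.c₅ ^ 2) * S ^ 2 / ((R + c.c₅ ^ 2) * C ^ 2)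
      = (c.c₅ ^ 2 + R * (C ^ 2 + S ^ 2)) / ((R + c.c₅ ^ 2) * C ^ 2) := by
    field_simp
    linear_combination c.c₅ ^ 2 * hcs
  have hsub : 1 - (R - c.c₅ ^ 2) * S ^ 2 / ((R + c.c₅ ^ 2) * C ^ 2)
      = (R + c.c₅ ^ 2 * (C ^ 2 + S ^ 2)) / ((R + c.c₅ ^ 2) * C ^ 2) := by
    field_simp
    linear_combination R * hcs
  rw [hk, hadd, hsub]
  constructor
  · field_simp
  · field_simp
    linear_combination S * hpq

/-- The radicand is the perfect square (R sinh(αt) / den)², and sgn t restores the sign of sinh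
because α > 0. At t = 0 both sides of the sign identity vanish. -/
theorem Valid.omega_eq {c : Consts} (hc : c.Valid) (t : ℝ) :
    c.omega t = c.rad * Real.sinh (c.α * t) / (c.c₁ * c.den t)
      - 2 * (c.c₃ / c.c₁) * (c.chiPsi t).im := by
  have h1 := hc.1
  have hR := hc.rad_pos
  have hR2 := c.rad_sq
  have hd := hc.den_pos t
  have hcs := Real.cosh_sq (c.α * t)
  have h4 := hc.c₄_eq
  have hsq : 1 - c.c₁ ^ 2 * c.eta t ^ 2 - 4 * c.c₁ ^ 2 * c.c₄ ^ 2 * c.eta t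
      = (c.rad * |Real.sinh (c.α * t)| / c.den t) ^ 2 := by
    rw [eta_eq, h4, div_pow _ (c.den t), div_pow _ (c.den t), mul_pow c.rad, sq_abs]
    field_simp
    unfold den
    linear_combination 2 * c.rad ^ 2 * hcs + 2 * hR2
  have hsgn : Real.sign t * |Real.sinh (c.α * t)| = Real.sinh (c.α * t) := by
    rcases lt_trichotomy t 0 with h | h | h
    · rw [Real.sign_of_neg h, abs_of_neg (Real.sinh_neg_iff.2 (mul_neg_of_pos_of_neg hc.2.2 h))]
      ring
    · simp [h]
    · rw [Real.sign_of_pos h, abs_of_pos (Real.sinh_pos_iff.2 (mul_pos hc.2.2 h)), one_mul]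
  rw [omega, hsq, Real.sqrt_sq (by positivity)]
  congr 1
  rw [← hsgn, abs_mul, abs_abs]
  rcases lt_trichotomy t 0 with h | h | h
  · simp [Real.sign_of_neg h]; field_simp
  · simp [h]
  · simp [Real.sign_of_pos h]; field_simp

theorem Valid.curve_eq {c : Consts} (hc : c.Valid) (t : ℝ) :
    c.curve t = ![2 / c.den t,
      c.rad * Real.sinh (c.α * t) / (c.c₁ * c.den t)
        - 2 * (c.c₃ / c.c₁) * (-(c.c₅ * Real.sinh (c.α * t)) / c.den t),
      -(c.c₅ * Real.sinh (c.α * t)) / c.den t,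
      c.c₅ * (c.rad + c.c₅ ^ 2 * Real.cosh (c.α * t)) / (2 * c.c₁ * c.den t)
        + c.c₃ / c.c₁] := by
  have h1 := hc.1
  have hd := (hc.den_pos t).ne'
  obtain ⟨hcos, hsin⟩ := hc.cos_sin_f t
  have he : Complex.exp (Complex.I * (c.f t : ℂ)) = ⟨Real.cos (c.f t), Real.sin (c.f t)⟩ := by
    rw [mul_comm, Complex.exp_mul_I]
    apply Complex.ext <;> simp [← Complex.ofReal_cos, ← Complex.ofReal_sin]
  have him : (c.chiPsi t).im = -(c.c₅ * Real.sinh (c.α * t)) / c.den t := by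
    simp only [chiPsi, he, Complex.add_im, Complex.mul_im, Complex.ofReal_re, Complex.ofReal_im]
    rw [hsin, hc.c₄_eq]
    field_simp
    ring
  have hre : (c.chiPsi t).re
      = c.c₅ * (c.rad + c.c₅ ^ 2 * Real.cosh (c.α * t)) / (2 * c.c₁ * c.den t)
        + c.c₃ / c.c₁ := by
    simp only [chiPsi, he, Complex.add_re, Complex.mul_re, Complex.ofReal_re, Complex.ofReal_im]
    rw [hcos, hc.c₄_eq]
    field_simp
    ring
  rw [curve, hc.omega_eq, him, hre, eta_eq]

/-- ω and ψ are odd in t because sinh is, while η and χ are even. Hence the boundary condition at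
-t₁ follows from the one at t₁. -/
theorem Valid.curve_neg {c : Consts} (hc : c.Valid) (t : ℝ) :
    c.curve (-t) = ![c.curve t 0, -c.curve t 1, -c.curve t 2, c.curve t 3] := by
  rw [hc.curve_eq, hc.curve_eq, den_neg]
  ext k
  fin_cases k <;> simp <;> ring

/-- The explicit curve is the image of the vertical geodesic under an isometry. -/
theorem Valid.exists_isometryPair {c : Consts} (hc : c.Valid) :
    ∃ Φ Ψ, IsIsometryPair Φ Ψ ∧ ∃ β, ∀ t, c.curve t = Φ (vert (c.α * t + β)) := by
  have h1 := hc.1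
  have hR := hc.rad_pos
  have hR2 := c.rad_sq
  -- `hT0` accounts for the shift of χ by c₃/c₁. Up to that shift, `hTa` moves the origin to the
  -- limit of the curve as t → ∞, and `hTb` moves it to the inverted limit as t → -∞, taken relative
  -- to the former. The parameter shift log(R/4) matches η ~ 4 / (R e^{αt}) as t → ∞.
  have hT0 := isIsometryPair_translation 0 0 (c.c₃ / c.c₁)
  have hTa := isIsometryPair_translation (1 / c.c₁) (-c.c₅ / c.rad)
    (c.c₅ ^ 3 / (2 * c.c₁ * c.rad))
  have hTb := isIsometryPair_translation (c.c₁ / 2) (c.c₅ ^ 3 / (2 * c.rad))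
    (c.c₅ * c.c₁ / c.rad)
  refine ⟨_, _, hT0.trans (hTa.trans (isIsometryPair_inversion.trans hTb)),
    Real.log (c.rad / 4), fun t => ?_⟩
  have hd := hc.den_pos t
  rw [hc.curve_eq]
  simp only [Function.comp_apply]
  set R := c.rad
  set E := Real.exp (c.α * t) with hE
  have hE0 : 0 < E := Real.exp_pos _
  have hC : Real.cosh (c.α * t) = (E + 1 / E) / 2 := by
    rw [Real.cosh_eq, Real.exp_neg, one_div]
  have hS : Real.sinh (c.α * t) = (E - 1 / E) / 2 := by
    rw [Real.sinh_eq, Real.exp_neg, one_div]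
  have hden : c.den t = c.c₅ ^ 2 + R * ((E + 1 / E) / 2) := by rw [← hC]; rfl
  set d := c.den t
  have hv : vert (c.α * t + Real.log (R / 4)) = ![E * R / 4, 0, 0, 0] := by
    rw [vert, Real.exp_add, Real.exp_log (by positivity), mul_div_assoc]
  have hb : translation (c.c₁ / 2) (c.c₅ ^ 3 / (2 * R)) (c.c₅ * c.c₁ / R) ![E * R / 4, 0, 0, 0]
      = ![E * R / 4, c.c₁ / 2, c.c₅ ^ 3 / (2 * R), c.c₅ * c.c₁ / R] := by
    simp [translation]
  have hA : E * R / 4 + (c.c₅ ^ 3 / (2 * R)) ^ 2 + (c.c₅ * c.c₁ / R) ^ 2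
      = (E * R + c.c₅ ^ 2) / 4 := by
    field_simp
    linear_combination (-4 * c.c₅ ^ 2) * hR2
  have hn : ((E * R + c.c₅ ^ 2) / 4) ^ 2 + (c.c₁ / 2) ^ 2 = R * E * d / 8 := by
    rw [hden]
    field_simp
    linear_combination (-32) * hR2
  have hi : inversion ![E * R / 4, c.c₁ / 2, c.c₅ ^ 3 / (2 * R), c.c₅ * c.c₁ / R]
      = ![2 / d, -(4 * c.c₁) / (R * E * d), c.c₅ * (c.c₅ ^ 2 * E + R) / (R * E * d),
        2 * c.c₅ * c.c₁ / (R * d)] := by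
    simp only [inversion, normU, Matrix.cons_val]
    rw [hA, hn]
    ext k
    fin_cases k
    · simp
      field_simp
      norm_num
    · simp
      field_simp
      norm_num
    · simp
      field_simp
      linear_combination (-8 * c.c₅) * hR2
    · simp
      field_simp
      ring
  rw [hv, hb, hi, hC, hS]
  simp only [translation, Matrix.cons_val]
  ext k
  fin_cases k
  · simp
  · simp
    rw [hden] at hd ⊢
    field_simp
    linear_combination (-2 * R - 2 * E * c.c₅ ^ 2) * hR2
  · simp
    rw [hden] at hd ⊢
    field_simp
    ring
  · simp
    rw [hden] at hd ⊢
    field_simp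
    linear_combination 2 * c.c₅ * E * hR2

end Consts

/-! ### The constants for centered boundary data -/

/-- `sinh (α |t₁|)` in terms of the centered boundary data. -/
noncomputable def sinhOf (η₁ ω₁ ψ₁ : ℝ) : ℝ := √(ω₁ ^ 2 + 4 * ψ₁ ^ 4 + 4 * η₁ * ψ₁ ^ 2) / η₁

theorem sinhOf_pos {η₁ ω₁ : ℝ} (ψ₁ : ℝ) (hη : 0 < η₁) (hω : ω₁ ≠ 0) : 0 < sinhOf η₁ ω₁ ψ₁ := by
  unfold sinhOf; positivity

theorem sinhOf_sq {η₁ : ℝ} (ω₁ ψ₁ : ℝ) (hη : 0 < η₁) :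
    η₁ ^ 2 * sinhOf η₁ ω₁ ψ₁ ^ 2 = ω₁ ^ 2 + 4 * ψ₁ ^ 4 + 4 * η₁ * ψ₁ ^ 2 := by
  rw [sinhOf, div_pow, Real.sq_sqrt (by positivity)]
  field_simp

/-- The constants of the explicit curve with centered boundary data. -/
noncomputable def constsOf (t₁ η₁ ω₁ ψ₁ : ℝ) : Consts :=
  let S := sinhOf η₁ ω₁ ψ₁
  let C := √(1 + S ^ 2)
  let c₅ := 2 * ψ₁ / (η₁ * S)
  let c₁ := -ω₁ / (η₁ ^ 2 * S * C)
  { c₁ := c₁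
    c₃ := -(c₅ * (√(4 * c₁ ^ 2 + c₅ ^ 4) + c₅ ^ 2 * C) * η₁ / 4)
    c₄ := c₅ / (2 * c₁)
    c₅ := c₅
    α := Real.arsinh S / -t₁ }

section

variable {t₁ η₁ ω₁ ψ₁ : ℝ}

theorem constsOf_valid (ht : t₁ < 0) (hη : 0 < η₁) (hω : ω₁ ≠ 0) :
    (constsOf t₁ η₁ ω₁ ψ₁).Valid := by
  have hS := sinhOf_pos ψ₁ hη hω
  have h1 : (constsOf t₁ η₁ ω₁ ψ₁).c₁ ≠ 0 := by
    have : 0 < √(1 + sinhOf η₁ ω₁ ψ₁ ^ 2) := by positivity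
    exact div_ne_zero (neg_ne_zero.2 hω) (by positivity)
  refine ⟨h1, ?_, div_pos (Real.arsinh_pos_iff.2 hS) (by linarith)⟩
  exact (mul_div_cancel₀ _ (mul_ne_zero two_ne_zero h1)).symm

/-- The value of `ω` at the end point in the gauge `χ(t₁) = 0`. -/
theorem omega_boundary {R C S c₁ c₅ η : ℝ} (h1 : c₁ ≠ 0) (hη : 0 < η)
    (hR : R ^ 2 = 4 * c₁ ^ 2 + c₅ ^ 4) (hd : η * (c₅ ^ 2 + R * C) = 2) :
    -(R * S * η / (2 * c₁)) + (c₅ * (R + c₅ ^ 2 * C) * η / (2 * c₁)) * (c₅ * S * η / 2)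
      = -(c₁ * C * S * η ^ 2) := by
  have hX : -R + c₅ ^ 2 * (R + c₅ ^ 2 * C) * η / 2 + 2 * c₁ ^ 2 * C * η = 0 := by
    linear_combination R / 2 * hd - C * η / 2 * hR
  have h : -(R * S * η / (2 * c₁)) + (c₅ * (R + c₅ ^ 2 * C) * η / (2 * c₁)) * (c₅ * S * η / 2)
      + c₁ * C * S * η ^ 2 = S * η / (2 * c₁)
        * (-R + c₅ ^ 2 * (R + c₅ ^ 2 * C) * η / 2 + 2 * c₁ ^ 2 * C * η) := by
    field_simp
  rw [hX] at h
  linarith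

/-- Once c₁ and c₅ are expressed through the boundary data, the squared condition η(c₅² + RC) = 2
becomes an equation for S alone: the two differences agree up to the factors (ηS)² and -4. The
existence and the uniqueness of the constants use one direction each. -/
theorem sinh_relation {R C S c₁ c₅ η w p : ℝ} (hη : η ≠ 0) (hS : S ≠ 0) (hC : C ^ 2 = 1 + S ^ 2)
    (hR : R ^ 2 = 4 * c₁ ^ 2 + c₅ ^ 4) (ha : c₁ * C * (η ^ 2 * S) = -w)
    (hb : c₅ * (η * S) = 2 * p) :
    (η * (R * C)) ^ 2 = (2 - η * c₅ ^ 2) ^ 2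
      ↔ η ^ 2 * S ^ 2 = w ^ 2 + 4 * p ^ 4 + 4 * η * p ^ 2 := by
  obtain rfl : w = -(c₁ * C * (η ^ 2 * S)) := by linarith
  obtain rfl : p = c₅ * (η * S) / 2 := by linarith
  have key : (η * S) ^ 2 * ((η * (R * C)) ^ 2 - (2 - η * c₅ ^ 2) ^ 2)
      = 4 * ((-(c₁ * C * (η ^ 2 * S))) ^ 2 + 4 * (c₅ * (η * S) / 2) ^ 4
        + 4 * η * (c₅ * (η * S) / 2) ^ 2 - η ^ 2 * S ^ 2) := by
    linear_combination η ^ 4 * S ^ 2 * C ^ 2 * hR + η ^ 4 * S ^ 2 * c₅ ^ 4 * hC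
  have h0 : (η * S) ^ 2 ≠ 0 := by positivity
  constructor
  · intro h
    rw [h, sub_self, mul_zero] at key
    linarith
  · intro h
    rw [← h, sub_self, mul_zero] at key
    exact sub_eq_zero.1 ((mul_eq_zero.1 key).resolve_left h0)

theorem curve_constsOf_left (ht : t₁ < 0) (hη : 0 < η₁) (hω : ω₁ ≠ 0) :
    (constsOf t₁ η₁ ω₁ ψ₁).curve t₁ = ![η₁, ω₁, ψ₁, 0] := by
  have hv := constsOf_valid (ψ₁ := ψ₁) ht hη hω
  have h1 := hv.1
  have hd := hv.den_pos t₁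
  have hR := hv.rad_pos
  have hR2 := (constsOf t₁ η₁ ω₁ ψ₁).rad_sq
  have hS := sinhOf_pos ψ₁ hη hω
  have hS2 := sinhOf_sq ω₁ ψ₁ hη
  have hαt : (constsOf t₁ η₁ ω₁ ψ₁).α * t₁ = -Real.arsinh (sinhOf η₁ ω₁ ψ₁) := by
    have := ht.ne
    simp only [constsOf]
    field_simp
  have hsinh : Real.sinh ((constsOf t₁ η₁ ω₁ ψ₁).α * t₁) = -sinhOf η₁ ω₁ ψ₁ := by
    rw [hαt, Real.sinh_neg, Real.sinh_arsinh]
  have hcosh : Real.cosh ((constsOf t₁ η₁ ω₁ ψ₁).α * t₁) = √(1 + sinhOf η₁ ω₁ ψ₁ ^ 2) := by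
    rw [hαt, Real.cosh_neg, Real.cosh_arsinh]
  have hc5 : (constsOf t₁ η₁ ω₁ ψ₁).c₅ = 2 * ψ₁ / (η₁ * sinhOf η₁ ω₁ ψ₁) := rfl
  have hc1 : (constsOf t₁ η₁ ω₁ ψ₁).c₁
      = -ω₁ / (η₁ ^ 2 * sinhOf η₁ ω₁ ψ₁ * √(1 + sinhOf η₁ ω₁ ψ₁ ^ 2)) := rfl
  have hc3 : (constsOf t₁ η₁ ω₁ ψ₁).c₃ = -((constsOf t₁ η₁ ω₁ ψ₁).c₅
      * ((constsOf t₁ η₁ ω₁ ψ₁).rad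
        + (constsOf t₁ η₁ ω₁ ψ₁).c₅ ^ 2 * √(1 + sinhOf η₁ ω₁ ψ₁ ^ 2)) * η₁ / 4) := rfl
  rw [hv.curve_eq, hsinh, hcosh]
  have hden : (constsOf t₁ η₁ ω₁ ψ₁).den t₁ = (constsOf t₁ η₁ ω₁ ψ₁).c₅ ^ 2
      + (constsOf t₁ η₁ ω₁ ψ₁).rad * √(1 + sinhOf η₁ ω₁ ψ₁ ^ 2) := by
    rw [Consts.den, hcosh]
  set c := constsOf t₁ η₁ ω₁ ψ₁
  have hC2 : √(1 + sinhOf η₁ ω₁ ψ₁ ^ 2) ^ 2 = 1 + sinhOf η₁ ω₁ ψ₁ ^ 2 :=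
    Real.sq_sqrt (by positivity)
  have hC : 0 < √(1 + sinhOf η₁ ω₁ ψ₁ ^ 2) := by positivity
  set S := sinhOf η₁ ω₁ ψ₁
  set C := √(1 + S ^ 2)
  set R := c.rad
  have hRC : R * C = 2 / η₁ - c.c₅ ^ 2 := by
    -- In this form the quantity is visibly nonnegative, which selects the correct root when
    -- `sinh_relation` is freed of its squares.
    have e1 : 2 / η₁ - c.c₅ ^ 2 = (2 * ω₁ ^ 2 + 8 * ψ₁ ^ 4 + 4 * η₁ * ψ₁ ^ 2) / (η₁ ^ 3 * S ^ 2) := by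
      rw [hc5]
      field_simp
      linear_combination 2 * hS2
    have e2 := (sinh_relation (R := R) hη.ne' hS.ne' hC2 hR2 (c₅ := c.c₅) (p := ψ₁)
      (w := ω₁) (by rw [hc1]; field_simp) (by rw [hc5]; field_simp)).2 hS2
    have e3 : 2 - η₁ * c.c₅ ^ 2 = η₁ * (2 / η₁ - c.c₅ ^ 2) := by field_simp
    rw [e3, mul_pow, mul_pow η₁] at e2
    replace e2 := mul_left_cancel₀ (by positivity) e2
    refine (sq_eq_sq₀ (by positivity) ?_).1 e2
    rw [e1]
    positivity
  have hη1 : η₁ * c.den t₁ = 2 := by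
    rw [hden, hRC]
    field_simp
    ring
  have hd2 : c.den t₁ = 2 / η₁ := by field_simp; linarith
  rw [hd2]
  ext k
  fin_cases k
  · simp
  · have hob := omega_boundary (S := S) h1 hη hR2 (by rw [← hden, hη1])
    have hω1 : ω₁ = -(c.c₁ * C * S * η₁ ^ 2) := by rw [hc1]; field_simp
    change R * -S / (c.c₁ * (2 / η₁)) - 2 * (c.c₃ / c.c₁) * (-(c.c₅ * -S) / (2 / η₁)) = ω₁
    rw [hω1, ← hob, hc3]
    field_simp
    ring
  · simp [hc5]
    field_simp
  · simp [hc3]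
    field_simp
    ring

/-- The conditions at t₁ can be solved one after another, with S = sinh(α|t₁|) and C = cosh(αt₁): ψ
gives c₅ = 2ψ₁/(η₁S), χ = 0 gives c₃, ω then becomes -c₁CSη₁² by `omega_boundary` and gives c₁, and
η determines S by `sinh_relation`. Injectivity of sinh yields α. -/
theorem consts_of_boundary {c : Consts} (hc : c.Valid) (ht : t₁ < 0) (hη : 0 < η₁)
    (hb : c.curve t₁ = ![η₁, ω₁, ψ₁, 0]) : c = constsOf t₁ η₁ ω₁ ψ₁ := by
  have h1 := hc.1
  have hd := hc.den_pos t₁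
  have hR := hc.rad_pos
  have hR2 := c.rad_sq
  rw [hc.curve_eq] at hb
  have b0 := congrFun hb 0
  have b1 := congrFun hb 1
  have b2 := congrFun hb 2
  have b3 := congrFun hb 3
  simp only [Matrix.cons_val] at b0 b1 b2 b3
  set S := Real.sinh (c.α * -t₁) with hSdef
  have hSn : Real.sinh (c.α * t₁) = -S := by rw [hSdef, mul_neg, Real.sinh_neg, neg_neg]
  have hS : 0 < S := Real.sinh_pos_iff.2 (mul_pos hc.2.2 (by linarith))
  set C := Real.cosh (c.α * t₁) with hCdef
  have hC0 : 0 < C := Real.cosh_pos _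
  have hC : C ^ 2 = 1 + S ^ 2 := by
    rw [hCdef, Real.cosh_sq, hSn]; ring
  rw [hSn] at b1 b2
  have hden : c.den t₁ = c.c₅ ^ 2 + c.rad * C := rfl
  have hdη : c.den t₁ = 2 / η₁ := by rw [← b0]; field_simp
  rw [hdη] at b0 b1 b2 b3 hden
  set R := c.rad
  have e5 : c.c₅ = 2 * ψ₁ / (η₁ * S) := by
    rw [← b2]; field_simp
  have e3 : c.c₃ = -(c.c₅ * (R + c.c₅ ^ 2 * C) * η₁ / 4) := by
    field_simp at b3 ⊢
    linarith
  have this : ω₁ = -(c.c₁ * C * S * η₁ ^ 2) := by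
    rw [← omega_boundary (S := S) h1 hη hR2 (by rw [← hden]; field_simp), ← b1, e3]
    field_simp
    ring
  have e1 : c.c₁ = -ω₁ / (η₁ ^ 2 * S * C) := by
    rw [this]
    field_simp
  have hSS : S = sinhOf η₁ ω₁ ψ₁ := by
    refine (sq_eq_sq₀ hS.le (by unfold sinhOf; positivity)).1 ?_
    have e4 : η₁ ^ 2 * S ^ 2 = ω₁ ^ 2 + 4 * ψ₁ ^ 4 + 4 * η₁ * ψ₁ ^ 2 := by
      refine (sinh_relation (R := R) hη.ne' hS.ne' hC hR2 (c₅ := c.c₅) (p := ψ₁)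
        (w := ω₁) ?_ (by rw [e5]; field_simp)).1 ?_
      · rw [this]; ring
      · have : R * C = 2 / η₁ - c.c₅ ^ 2 := by rw [hden]; ring
        rw [this]
        field_simp
    have := sinhOf_sq ω₁ ψ₁ hη
    have h0 : η₁ ^ 2 ≠ 0 := by positivity
    exact mul_left_cancel₀ h0 (e4.trans this.symm)
  have hCC : C = √(1 + sinhOf η₁ ω₁ ψ₁ ^ 2) := by
    rw [← hSS, ← hC, Real.sqrt_sq hC0.le]
  have eα : c.α = Real.arsinh (sinhOf η₁ ω₁ ψ₁) / -t₁ := by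
    have := ht.ne
    rw [← hSS, hSdef, Real.arsinh_sinh]
    field_simp
  have e4 := hc.c₄_eq
  have hRd : R = √(4 * c.c₁ ^ 2 + c.c₅ ^ 4) := rfl
  rw [hRd] at e3
  rw [hSS] at e5 e1
  rw [hCC] at e1 e3
  obtain ⟨c1, c3, c4, c5, α⟩ := c
  simp only at e1 e3 e4 e5 eα
  subst e4 e3 e5 e1 eα
  rfl

end

/-- The unique minimizer of the energy for centered boundary data is explicit. -/
theorem exists_unique_consts {t₁ η₁ ω₁ ψ₁ : ℝ} (ht : t₁ < 0) (hη : 0 < η₁) (hω : ω₁ ≠ 0) :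
    ∃ c : Consts,
      (c.Valid ∧ c.curve t₁ = ![η₁, ω₁, ψ₁, 0] ∧ c.curve (-t₁) = ![η₁, -ω₁, -ψ₁, 0]) ∧
      (∀ c' : Consts, c'.Valid → c'.curve t₁ = ![η₁, ω₁, ψ₁, 0] →
        c'.curve (-t₁) = ![η₁, -ω₁, -ψ₁, 0] → c' = c) ∧
      IsEnergyMinimizer t₁ (-t₁) ![η₁, ω₁, ψ₁, 0] ![η₁, -ω₁, -ψ₁, 0] c.curve ∧
      (∀ ζ, IsEnergyMinimizer t₁ (-t₁) ![η₁, ω₁, ψ₁, 0] ![η₁, -ω₁, -ψ₁, 0] ζ →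
        EqOn ζ c.curve (Icc t₁ (-t₁))) ∧
      IsAffineMinimizingGeodesic c.curve t₁ (-t₁) c.α := by
  set c := constsOf t₁ η₁ ω₁ ψ₁ with hc
  have hv : c.Valid := constsOf_valid ht hη hω
  have h1 : c.curve t₁ = ![η₁, ω₁, ψ₁, 0] := curve_constsOf_left ht hη hω
  have h2 : c.curve (-t₁) = ![η₁, -ω₁, -ψ₁, 0] := by
    rw [hv.curve_neg, h1]; rfl
  obtain ⟨Φ, Ψ, h, β, hΦ⟩ := hv.exists_isometryPair
  obtain ⟨m1, m2⟩ := h.isEnergyMinimizer (γ := c.curve) (show t₁ < -t₁ by linarith)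
    (fun t _ => hΦ t)
  rw [h1, h2] at m1 m2
  exact ⟨c, ⟨hv, h1, h2⟩, fun c' hv' hb _ => consts_of_boundary hv' ht hη hb, m1, m2,
    h.isAffineMinimizingGeodesic hv.2.2.le (by linarith) fun t _ => hΦ t⟩

theorem tOf_neg {θ : ℝ} (h0 : 0 < θ) (hπ : θ < π / 2) : tOf θ < 0 :=
  Real.log_neg (tan_half_pos h0 (by linarith)) (by
    rw [← Real.tan_pi_div_four]
    exact Real.tan_lt_tan_of_lt_of_lt_pi_div_two (by linarith) (by linarith) (by linarith))

theorem tOf_pi_sub (θ : ℝ) : tOf (π - θ) = -tOf θ := by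
  rw [tOf, tOf, sub_div, Real.tan_pi_div_two_sub, Real.log_inv]

/-- The minimizer of `𝓜` for centered boundary data is explicit. -/
theorem eqOn_of_isMassMinimizer {θ₁ σ₁ ω₁ ψ₁ : ℝ} {D : ℝ → Fin 4 → ℝ} (h0 : 0 < θ₁)
    (hπ : θ₁ < π / 2) (hω : ω₁ ≠ 0)
    (hD : IsMassMinimizer θ₁ (π - θ₁) ![σ₁, ω₁, ψ₁, 0] ![σ₁, -ω₁, -ψ₁, 0] D) :
    let c := constsOf (tOf θ₁) (Real.exp σ₁ * Real.sin θ₁ ^ 2) ω₁ ψ₁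
    c.Valid ∧ EqOn (curveOf D) c.curve (Icc (tOf θ₁) (tOf (π - θ₁))) ∧
      ∀ x ∈ Icc θ₁ (π - θ₁), D x 0 = -Real.log (1 / 2 * c.c₅ ^ 2 * Real.sin x ^ 2
        + 1 / 2 * √(4 * c.c₁ ^ 2 + c.c₅ ^ 4) * Real.sin x ^ 2 * Real.cosh (c.α * tOf x)) := by
  intro c
  have h12 : θ₁ < π - θ₁ := by linarith
  have h2 : π - θ₁ < π := by linarith
  have ht := tOf_neg h0 hπ
  have hs := Real.sin_pos_of_pos_of_lt_pi h0 (h12.trans h2)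
  have hη : 0 < Real.exp σ₁ * Real.sin θ₁ ^ 2 := by positivity
  have hv : c.Valid := constsOf_valid ht hη hω
  have h1 : c.curve (tOf θ₁) = ![Real.exp σ₁ * Real.sin θ₁ ^ 2, ω₁, ψ₁, 0] :=
    curve_constsOf_left ht hη hω
  obtain ⟨Φ, Ψ, h, β, hΦ⟩ := hv.exists_isometryPair
  -- The explicit curve, rewritten as potentials in θ, has the same Dirichlet data and is a
  -- minimizer, so uniqueness identifies it with `D`.
  set D' := potentialsOf (fun θ => c.curve (tOf θ)) with hD'
  have hpos (t : ℝ) : 0 < c.curve t 0 := by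
    rw [hΦ]
    exact h.left.pos _ (vert_pos _)
  have hpc {x : ℝ} (hx : x ∈ Icc θ₁ (π - θ₁)) : potentialCurve D' x = c.curve (tOf x) :=
    potentialCurve_potentialsOf (h0.trans_le hx.1) (hx.2.trans_lt h2) (hpos _)
  have hD1 : D' θ₁ = ![σ₁, ω₁, ψ₁, 0] := by
    refine eq_of_potentialCurve_eq (E := fun _ => ![σ₁, ω₁, ψ₁, 0]) h0 (h12.trans h2) ?_
    rw [hpc (left_mem_Icc.2 h12.le), h1]
    rfl
  have hD2 : D' (π - θ₁) = ![σ₁, -ω₁, -ψ₁, 0] := by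
    refine eq_of_potentialCurve_eq (E := fun _ => ![σ₁, -ω₁, -ψ₁, 0]) (h0.trans h12) h2 ?_
    rw [hpc (right_mem_Icc.2 h12.le), tOf_pi_sub, hv.curve_neg, h1]
    simp [potentialCurve, etaOf]
  obtain ⟨-, m2, -⟩ := h.isMassMinimizer (D := D') (α := c.α) (β := β) h0 h12 h2
    fun x hx => by rw [hpc hx, hΦ]
  rw [hD1, hD2] at m2
  have heq := m2 D hD
  refine ⟨hv, fun t htm => ?_, fun x hx => ?_⟩
  · have hm := thetaOf_mem_Icc h0 h12 h2 htm
    have : potentialCurve D (thetaOf t) = potentialCurve D' (thetaOf t) := by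
      simp only [potentialCurve, etaOf, heq hm]
    rw [curveOf_eq, this, hpc hm, tOf_thetaOf]
  · have hsx := Real.sin_pos_of_pos_of_lt_pi (h0.trans_le hx.1) (hx.2.trans_lt h2)
    rw [heq hx]
    change Real.log (c.eta (tOf x)) - 2 * Real.log (Real.sin x) = _
    have hpos' : 0 < 1 / 2 * c.c₅ ^ 2
        + 1 / 2 * √(4 * c.c₁ ^ 2 + c.c₅ ^ 4) * Real.cosh (c.α * tOf x) :=
      inv_pos.1 (hpos (tOf x))
    rw [Consts.eta, Real.log_inv, show ∀ a b s d : ℝ, a * s + b * s * d = (a + b * d) * s by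
      intros; ring, Real.log_mul hpos'.ne' (by positivity), Real.log_pow]
    push_cast
    ring

/-! ### The limit in which the end points tend to the poles -/

/-- From sin θ = 2 cos²(θ/2) tan(θ/2): near the pole, t agrees with ln sin θ up to a term tending to
ln 2. -/
theorem log_two_mul_cos_sq {θ : ℝ} (h0 : 0 < θ) (hπ : θ < π) :
    Real.log (Real.sin θ) - tOf θ = Real.log (2 * Real.cos (θ / 2) ^ 2) := by
  have hs := Real.sin_pos_of_pos_of_lt_pi h0 hπ
  have hc : 0 < Real.cos (θ / 2) := Real.cos_pos_of_mem_Ioo ⟨by linarith, by linarith⟩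
  have hs2 : 0 < Real.sin (θ / 2) := Real.sin_pos_of_pos_of_lt_pi (by linarith) (by linarith)
  rw [tOf, ← Real.log_div hs.ne' (tan_half_pos h0 hπ).ne', Real.tan_eq_sin_div_cos]
  congr 1
  have h3 : Real.sin θ = 2 * Real.sin (θ / 2) * Real.cos (θ / 2) := by
    rw [← Real.sin_two_mul]; ring_nf
  rw [h3]
  field_simp

/-- The quotient of θ/2 by tan(θ/2), written with sinc so that its limit 1 at θ = 0 follows from
continuity. -/
theorem log_half_sub_tOf {θ : ℝ} (h0 : 0 < θ) (hπ : θ < π) :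
    Real.log (θ / 2) - tOf θ = Real.log (Real.cos (θ / 2) / Real.sinc (θ / 2)) := by
  have hs2 : 0 < Real.sin (θ / 2) := Real.sin_pos_of_pos_of_lt_pi (by linarith) (by linarith)
  rw [tOf, ← Real.log_div (by positivity) (tan_half_pos h0 hπ).ne', Real.tan_eq_sin_div_cos,
    Real.sinc_of_ne_zero (by positivity)]
  congr 1
  field_simp

section

variable {θ σ₁ ω₁ ψ₁ : ℝ}

/-- `η S` in terms of the centered boundary data. -/
noncomputable def rootOf (η ω₁ ψ₁ : ℝ) : ℝ := √(ω₁ ^ 2 + 4 * ψ₁ ^ 4 + 4 * η * ψ₁ ^ 2)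

theorem constsOf_c₅ (t : ℝ) {η : ℝ} (hη : 0 < η) :
    (constsOf t η ω₁ ψ₁).c₅ = 2 * ψ₁ / rootOf η ω₁ ψ₁ := by
  change 2 * ψ₁ / (η * (rootOf η ω₁ ψ₁ / η)) = _
  rw [mul_div_cancel₀ _ hη.ne']

theorem mul_sqrt_one_add {η q : ℝ} (hη : 0 < η) :
    √(1 + (q / η) ^ 2) = √(η ^ 2 + q ^ 2) / η := by
  rw [← Real.sqrt_sq hη.le, ← Real.sqrt_div (by positivity), Real.sqrt_sq hη.le]
  congr 1
  field_simp

theorem constsOf_c₁ (t : ℝ) {η : ℝ} (hη : 0 < η) : (constsOf t η ω₁ ψ₁).c₁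
    = -ω₁ / (rootOf η ω₁ ψ₁ * √(η ^ 2 + rootOf η ω₁ ψ₁ ^ 2)) := by
  change -ω₁ / (η ^ 2 * (rootOf η ω₁ ψ₁ / η) * √(1 + (rootOf η ω₁ ψ₁ / η) ^ 2)) = _
  rw [mul_sqrt_one_add hη]
  congr 1
  field_simp

/-- With q = `rootOf`, arsinh(q/η) = ln(q + √(η² + q²)) - ln η and ln η = σ₁ + 2 ln sin θ. The
divergence of 2 ln sin θ is cancelled by 2t, so the right side converges as θ → 0. -/
theorem constsOf_α (h0 : 0 < θ) (hπ : θ < π / 2) (hω : ω₁ ≠ 0) (σ₁ ψ₁ : ℝ) :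
    let η := Real.exp σ₁ * Real.sin θ ^ 2
    ((constsOf (tOf θ) η ω₁ ψ₁).α - 2) * -tOf θ
      = Real.log (rootOf η ω₁ ψ₁ + √(η ^ 2 + rootOf η ω₁ ψ₁ ^ 2)) - σ₁
        - 2 * Real.log (2 * Real.cos (θ / 2) ^ 2) := by
  intro η
  have ht := (tOf_neg h0 hπ).ne
  have hs := Real.sin_pos_of_pos_of_lt_pi h0 (by linarith)
  have hη : 0 < η := by positivity
  have hq : 0 < rootOf η ω₁ ψ₁ := by unfold rootOf; positivity
  have hα : (constsOf (tOf θ) η ω₁ ψ₁).α * -tOf θ = Real.arsinh (rootOf η ω₁ ψ₁ / η) := by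
    change Real.arsinh (rootOf η ω₁ ψ₁ / η) / -tOf θ * -tOf θ = _
    field_simp
  have hlogη : Real.log η = σ₁ + 2 * Real.log (Real.sin θ) := by
    rw [Real.log_mul (Real.exp_ne_zero _) (by positivity), Real.log_exp, Real.log_pow]
    norm_num
  rw [sub_mul, hα, Real.arsinh, mul_sqrt_one_add hη, ← add_div,
    Real.log_div (by positivity) hη.ne', hlogη, ← log_two_mul_cos_sq h0 (by linarith)]
  ring

end

/-- The product (α - 2)(-t) converges to -Γ while -t → ∞, which forces α → 2. As ln(θ/2) - t → 0,
the same product also gives the limit of (θ/2)^(α - 2). -/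
theorem tendsto_constsOf {J Q σl Γ : ℝ} {θ σ₁ ω₁ ψ₁ : ℕ → ℝ} (hJQ : J ≠ 0 ∨ Q ≠ 0)
    (hσl : σl = 1 / 2 * Real.log (Q ^ 4 + 4 * J ^ 2) + Γ) (hθ : ∀ i, 0 < θ i ∧ θ i < π / 2)
    (hθ0 : Tendsto θ atTop (𝓝 0)) (hσ : Tendsto σ₁ atTop (𝓝 σl))
    (hω : Tendsto ω₁ atTop (𝓝 (-4 * J))) (hψ : Tendsto ψ₁ atTop (𝓝 (-Q)))
    (hω0 : ∀ i, ω₁ i ≠ 0) :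
    let c := fun i => constsOf (tOf (θ i)) (Real.exp (σ₁ i) * Real.sin (θ i) ^ 2) (ω₁ i) (ψ₁ i)
    Tendsto (fun i => (c i).α) atTop (𝓝 2) ∧
    Tendsto (fun i => (c i).c₅) atTop (𝓝 (-Q / √(Q ^ 4 + 4 * J ^ 2))) ∧
    Tendsto (fun i => (c i).c₁) atTop (𝓝 (J / (Q ^ 4 + 4 * J ^ 2))) ∧
    Tendsto (fun i => (θ i / 2) ^ ((c i).α - 2)) atTop (𝓝 (Real.exp Γ)) := by
  intro c
  set M := Q ^ 4 + 4 * J ^ 2 with hM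
  have hM0 : 0 < M := by rcases hJQ with h | h <;> positivity
  set η := fun i => Real.exp (σ₁ i) * Real.sin (θ i) ^ 2 with hηdef
  have hη (i : ℕ) : 0 < η i := by
    have := Real.sin_pos_of_pos_of_lt_pi (hθ i).1 (by linarith [(hθ i).2, Real.pi_pos])
    positivity
  have hη0 : Tendsto η atTop (𝓝 0) := by
    have h1 := (Real.continuous_exp.tendsto σl).comp hσ
    have h2 := ((Real.continuous_sin.tendsto 0).comp hθ0).pow 2
    simpa using! h1.mul h2
  set q := fun i => rootOf (η i) (ω₁ i) (ψ₁ i) with hq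
  have hql : Tendsto q atTop (𝓝 (2 * √M)) := by
    have h1 : Tendsto (fun i => ω₁ i ^ 2 + 4 * ψ₁ i ^ 4 + 4 * η i * ψ₁ i ^ 2) atTop
        (𝓝 ((-4 * J) ^ 2 + 4 * (-Q) ^ 4 + 4 * 0 * (-Q) ^ 2)) :=
      ((hω.pow 2).add ((hψ.pow 4).const_mul 4)).add ((hη0.const_mul 4).mul (hψ.pow 2))
    have h2 := h1.sqrt
    have h3 : 2 * √M = √((-4 * J) ^ 2 + 4 * (-Q) ^ 4 + 4 * 0 * (-Q) ^ 2) := by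
      rw [show (-4 * J) ^ 2 + 4 * (-Q) ^ 4 + 4 * 0 * (-Q) ^ 2 = 2 ^ 2 * M by rw [hM]; ring,
        Real.sqrt_mul (by positivity), Real.sqrt_sq (by norm_num)]
    rw [h3]
    exact h2
  have hsM : 0 < √M := Real.sqrt_pos.2 hM0
  have hr : Tendsto (fun i => √(η i ^ 2 + q i ^ 2)) atTop (𝓝 (2 * √M)) := by
    have h2 := ((hη0.pow 2).add (hql.pow 2)).sqrt
    rwa [zero_pow two_ne_zero, zero_add, Real.sqrt_sq (by positivity)] at h2
  have hcos : Tendsto (fun i => Real.cos (θ i / 2)) atTop (𝓝 1) := by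
    simpa using! (Real.continuous_cos.tendsto (0 / 2)).comp (hθ0.div_const 2)
  have hsinc : Tendsto (fun i => Real.sinc (θ i / 2)) atTop (𝓝 1) := by
    simpa using! (Real.continuous_sinc.tendsto (0 / 2)).comp (hθ0.div_const 2)
  have hkey : Tendsto (fun i => ((c i).α - 2) * -tOf (θ i)) atTop (𝓝 (-Γ)) := by
    have h1 : Tendsto (fun i => Real.log (q i + √(η i ^ 2 + q i ^ 2)) - σ₁ i
        - 2 * Real.log (2 * Real.cos (θ i / 2) ^ 2)) atTop
        (𝓝 (Real.log (2 * √M + 2 * √M) - σl - 2 * Real.log (2 * 1 ^ 2))) :=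
      (((hql.add hr).log (by positivity)).sub hσ).sub
        ((((hcos.pow 2).const_mul 2).log (by norm_num)).const_mul 2)
    -- The terms in ln 2 cancel, leaving ½ ln M - σ_l, which is -Γ by the definition of Γ.
    have h2 : Real.log (2 * √M + 2 * √M) - σl - 2 * Real.log (2 * 1 ^ 2) = -Γ := by
      rw [hσl, show 2 * √M + 2 * √M = 2 ^ 2 * √M by ring,
        Real.log_mul (by norm_num) hsM.ne', Real.log_pow, Real.log_sqrt hM0.le]
      push_cast
      ring_nf
    rw [h2] at h1
    exact h1.congr fun i => (constsOf_α (hθ i).1 (hθ i).2 (hω0 i) (σ₁ i) (ψ₁ i)).symm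
  have ht : Tendsto (fun i => -tOf (θ i)) atTop atTop := by
    have h1 : Tendsto (fun i => Real.tan (θ i / 2)) atTop (𝓝[≠] 0) := by
      refine tendsto_nhdsWithin_iff.2 ⟨?_, Eventually.of_forall fun i =>
        (tan_half_pos (hθ i).1 (by linarith [(hθ i).2, Real.pi_pos])).ne'⟩
      have h2 : ContinuousAt Real.tan (0 / 2) := Real.continuousAt_tan.2 (by simp)
      simpa using! h2.tendsto.comp (hθ0.div_const 2)
    exact tendsto_neg_atBot_atTop.comp (Real.tendsto_log_nhdsNE_zero.comp h1)
  have hα2 : Tendsto (fun i => (c i).α - 2) atTop (𝓝 0) := by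
    refine (hkey.div_atTop ht).congr fun i => ?_
    have := (tOf_neg (hθ i).1 (hθ i).2).ne
    field_simp
  refine ⟨?_, ?_, ?_, ?_⟩
  · simpa using hα2.add_const 2
  · have h1 := (hψ.const_mul 2).div hql (by positivity)
    have h2 : 2 * -Q / (2 * √M) = -Q / √M := by field_simp
    rw [h2] at h1
    exact h1.congr fun i => (constsOf_c₅ _ (hη i)).symm
  · have h1 := hω.neg.div (hql.mul hr) (by positivity)
    have h2 : -(-4 * J) / (2 * √M * (2 * √M)) = J / M := by
      rw [show 2 * √M * (2 * √M) = 4 * (√M) ^ 2 by ring, Real.sq_sqrt hM0.le]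
      field_simp
    rw [h2] at h1
    exact h1.congr fun i => (constsOf_c₁ _ (hη i)).symm
  -- The logarithm of (θ/2)^(α - 2) is (α - 2)t plus (α - 2) times a term tending to 0.
  · have h1 : Tendsto (fun i => -(((c i).α - 2) * -tOf (θ i)) + ((c i).α - 2)
        * Real.log (Real.cos (θ i / 2) / Real.sinc (θ i / 2))) atTop
        (𝓝 (-(-Γ) + 0 * Real.log (1 / 1))) :=
      hkey.neg.add (hα2.mul ((hcos.div hsinc one_ne_zero).log (by norm_num)))
    rw [neg_neg, zero_mul, add_zero] at h1
    refine ((Real.continuous_exp.tendsto Γ).comp h1).congr fun i => ?_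
    have h0 := (hθ i).1
    rw [Function.comp_apply, ← log_half_sub_tOf h0 (by linarith [(hθ i).2, Real.pi_pos]),
      Real.rpow_def_of_pos (by positivity)]
    congr 1
    ring

end CH2

/-! ### The three statements combined -/

theorem lemma4 :
    -- (1) existence, uniqueness, smoothness and geodesic nature of the minimizer
    (∀ (θ₁ θ₂ : ℝ) (p q : Fin 4 → ℝ), 0 < θ₁ → θ₁ < θ₂ → θ₂ < π →
      ∃ D : ℝ → Fin 4 → ℝ,
        IsMassMinimizer θ₁ θ₂ p q D ∧
        (∀ E, IsMassMinimizer θ₁ θ₂ p q E → EqOn E D (Icc θ₁ θ₂)) ∧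
        ContDiffOn ℝ ∞ D (Icc θ₁ θ₂) ∧
        ∃ α : ℝ, IsAffineMinimizingGeodesic (curveOf D) (tOf θ₁) (tOf θ₂) α) ∧
    -- (2) the explicit minimizer for centered boundary data
    (∀ t₁ η₁ ω₁ ψ₁ : ℝ, t₁ < 0 → 0 < η₁ → ω₁ ≠ 0 →
      ∃ c : Consts,
        (c.Valid ∧ c.curve t₁ = ![η₁, ω₁, ψ₁, 0] ∧ c.curve (-t₁) = ![η₁, -ω₁, -ψ₁, 0]) ∧
        (∀ c' : Consts, c'.Valid → c'.curve t₁ = ![η₁, ω₁, ψ₁, 0] →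
          c'.curve (-t₁) = ![η₁, -ω₁, -ψ₁, 0] → c' = c) ∧
        IsEnergyMinimizer t₁ (-t₁) ![η₁, ω₁, ψ₁, 0] ![η₁, -ω₁, -ψ₁, 0] c.curve ∧
        (∀ ζ, IsEnergyMinimizer t₁ (-t₁) ![η₁, ω₁, ψ₁, 0] ![η₁, -ω₁, -ψ₁, 0] ζ →
          EqOn ζ c.curve (Icc t₁ (-t₁))) ∧
        IsAffineMinimizingGeodesic c.curve t₁ (-t₁) c.α) ∧
    -- (3) the limit in which the end points tend to the poles
    (∀ (J Q σl Γ : ℝ) (θ σ₁ ω₁ ψ₁ : ℕ → ℝ) (D : ℕ → ℝ → Fin 4 → ℝ),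
      (J ≠ 0 ∨ Q ≠ 0) →
      σl = 1 / 2 * Real.log (Q ^ 4 + 4 * J ^ 2) + Γ →
      (∀ i, 0 < θ i ∧ θ i < π / 2) → Tendsto θ atTop (𝓝 0) →
      Tendsto σ₁ atTop (𝓝 σl) → Tendsto ω₁ atTop (𝓝 (-4 * J)) → Tendsto ψ₁ atTop (𝓝 (-Q)) →
      (∀ i, ω₁ i ≠ 0) →
      (∀ i, IsMassMinimizer (θ i) (π - θ i)
        ![σ₁ i, ω₁ i, ψ₁ i, 0] ![σ₁ i, -ω₁ i, -ψ₁ i, 0] (D i)) →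
      ∃ c : ℕ → Consts,
        (∀ i, (c i).Valid ∧
          EqOn (curveOf (D i)) (c i).curve (Icc (tOf (θ i)) (tOf (π - θ i))) ∧
          ∀ x ∈ Icc (θ i) (π - θ i),
            D i x 0 = -Real.log (1 / 2 * (c i).c₅ ^ 2 * Real.sin x ^ 2
              + 1 / 2 * √(4 * (c i).c₁ ^ 2 + (c i).c₅ ^ 4) * Real.sin x ^ 2
                * Real.cosh ((c i).α * tOf x))) ∧
        Tendsto (fun i => (c i).α) atTop (𝓝 2) ∧
        Tendsto (fun i => (c i).c₅) atTop (𝓝 (-Q / √(Q ^ 4 + 4 * J ^ 2))) ∧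
        Tendsto (fun i => (c i).c₁) atTop (𝓝 (J / (Q ^ 4 + 4 * J ^ 2))) ∧
        Tendsto (fun i => (θ i / 2) ^ ((c i).α - 2)) atTop (𝓝 (Real.exp Γ))) := by
  refine ⟨fun θ₁ θ₂ p q h1 h12 h2 => exists_isMassMinimizer p q h1 h12 h2,
    fun t₁ η₁ ω₁ ψ₁ ht hη hω => exists_unique_consts ht hη hω, ?_⟩
  intro J Q σl Γ θ σ₁ ω₁ ψ₁ D hJQ hσl hθ hθ0 hσ hω hψ hω0 hD
  exact ⟨_, fun i => eqOn_of_isMassMinimizer (hθ i).1 (hθ i).2 (hω0 i) (hD i),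
    tendsto_constsOf hJQ hσl hθ hθ0 hσ hω hψ hω0⟩
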